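/- Let $X=\bigoplus_{i\in\frac12\mathbb Z}X^i$ be a finite-dimensional real graded symplectic space, i.e. $X$ carries a symplectic form $\sigma$ (only its class up to scaling matters) with $\sigma(X^i,X^j)=0$ whenever $i+j\ne0$. Let $\rho$ be a symplectic flag symbol on $X$, represented by an endomorphism $\rho\in\mathfrak{csp}(X)$ of degree $-1$, i.e. $\rho(X^i)\subset X^{i-1}$ for all $i$ (for instance the modified Jacobi symbol $\rho=\delta_{\rm mod}$ of a vector distribution). The indecomposable symbols and their diagrams are the following; the columns of a diagram are indexed by weights decreasing by $1$ at each step from left to right. (i) $\delta_{s,l}$, where either $s\ge 0$ is an integer and $l$ is an integer with $0\le l\le 2s$, or $s>0$ is half of an odd integer and $l$ is an integer with $0\le l\le 2s-1$. It acts on the space with basis $e_{s-l},\dots,e_s,f_{-s},\dots,f_{l-s}$, the index being the weight, by $e_i\mapsto e_{i-1}$, $f_i\mapsto f_{i-1}$ (and $e_{s-l},f_{-s}\mapsto 0$); here $\sigma(e_i,f_{-i})=(-1)^{s-i}$ and all other products of an $e$ or $f$ with an $e$ or $f$ vanish, up to skew-symmetry. Its diagram has two rows of $l+1$ boxes, one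 occupying the weights $s,\dots,s-l$ and one the weights $l-s,\dots,-s$. (ii) $\tau_m$, where $m>0$ is half of an odd integer. It acts on the space with basis $\varepsilon_{-m},\dots,\varepsilon_m$ by $\varepsilon_i\mapsto\varepsilon_{i-1}$ (and $\varepsilon_{-m}\mapsto 0$); here $\sigma(\varepsilon_i,\varepsilon_{-i})=\pm(-1)^{m-i}$ with one sign $\pm$ for the whole space, all other products being $0$. Its diagram has one row of $2m+1$ boxes, occupying the weights $m,\dots,-m$. The symbol $\rho$ is isomorphic to a finite (skew-orthogonal, graded) direct sum of such symbols. A skew Young diagram $\mathrm{Diag}(\rho)$ of $\rho$ is obtained by attaching the diagrams of the components of such a decomposition, boxes of equal weight being placed in the same column. There is also an $\mathfrak{sl}_2$-triple $(h,e,\rho)$ in $\mathfrak{sp}(X)$, that is $[e,\rho]=h$, $[h,e]=2e$, $[h,\rho]=-2\rho$, with $h$ of degree $0$ and $e$ of degree $1$ (all three being $0$ if $\rho=0$). For such a triple let $\mathfrak l(X)$ be the maximal $\mathfrak{sl}_2$-submodule of $\mathfrak{sp}(X)$, with respect to the commutator action, that is contained in the non-negative degree part of $\mathfrak{sp}(X)$.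 Then, for every skew Young diagram $\mathrm{Diag}(\rho)$ of $\rho$ and every such triple, the algebra $\mathfrak l(X)$ contains an endomorphism of rank $1$ if and only if $\mathrm{Diag}(\rho)$ contains two distinct rows such that the leftmost box of one of them is located in the same column as, or to the right of, the rightmost box of the other. -/

import Mathlib

/-! ### Graded symplectic spaces and their endomorphisms

The weights of the grading are the half-integers `½ℤ`, written as rational numbers. The three index
sets `ℤ`, `½ℤ_odd` and `½ℤ` are all covered: gradings by the first two are gradings by `½ℤ` in
which the other weight spaces vanish. -/

section Graded

variable {V : Type*} [AddCommGroup V] [Module ℝ V]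

/-- `X = ⨁ 𝒳 i` is a `½ℤ`-graded symplectic space with symplectic form `σ`, such that `𝒳 i` and
`𝒳 j` are skew-orthogonal whenever `i + j ≠ 0`. (A conformal symplectic structure is represented by
one of its forms; nothing below changes when `σ` is rescaled.) -/
structure IsGradedSymplectic (𝒳 : ℚ → Submodule ℝ V) (σ : LinearMap.BilinForm ℝ V) : Prop where
  internal : DirectSum.IsInternal 𝒳
  halfInt : ∀ q : ℚ, (¬ ∃ n : ℤ, q = (n : ℚ) / 2) → 𝒳 q = ⊥
  alt : σ.IsAlt
  nondegenerate : σ.Nondegenerate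
  orthogonal : ∀ i j : ℚ, i + j ≠ 0 → ∀ x ∈ 𝒳 i, ∀ y ∈ 𝒳 j, σ x y = 0

/-- The endomorphism `A` is homogeneous of degree `j`. -/
def HasDegree (𝒳 : ℚ → Submodule ℝ V) (j : ℚ) (A : Module.End ℝ V) : Prop :=
  ∀ i : ℚ, ∀ x ∈ 𝒳 i, A x ∈ 𝒳 (i + j)

/-- The conformal symplectic algebra, as a condition on endomorphisms. -/
def IsConformalSymplectic (σ : LinearMap.BilinForm ℝ V) (A : Module.End ℝ V) : Prop :=
  ∃ c : ℝ, ∀ x y, σ (A x) y + σ x (A y) = c * σ x y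

/-- `ρ` represents a symplectic flag symbol: it spans a line of degree `-1` endomorphisms
in the conformal symplectic algebra (`ρ = 0` being allowed). -/
structure IsSymplecticFlagSymbol (𝒳 : ℚ → Submodule ℝ V) (σ : LinearMap.BilinForm ℝ V)
    (ρ : Module.End ℝ V) : Prop where
  conformal : IsConformalSymplectic σ ρ
  degree : HasDegree 𝒳 (-1) ρ

/-- The symplectic algebra `𝔰𝔭(X)`: all `A` with `σ (A x) y = -σ x (A y)`. -/
abbrev spAlg (σ : LinearMap.BilinForm ℝ V) : Submodule ℝ (Module.End ℝ V) :=
  σ.skewAdjointSubmodule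

/-- The degree `j` component `𝔰𝔭^j(X)` of `𝔰𝔭(X)`. -/
def spDeg (𝒳 : ℚ → Submodule ℝ V) (σ : LinearMap.BilinForm ℝ V) (j : ℚ) :
    Submodule ℝ (Module.End ℝ V) where
  carrier := {A | A ∈ spAlg σ ∧ HasDegree 𝒳 j A}
  zero_mem' := ⟨(spAlg σ).zero_mem, fun i _ _ => (𝒳 (i + j)).zero_mem⟩
  add_mem' := fun ha hb => ⟨(spAlg σ).add_mem ha.1 hb.1, fun i x hx =>
    (𝒳 (i + j)).add_mem (ha.2 i x hx) (hb.2 i x hx)⟩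
  smul_mem' := fun c _ ha => ⟨(spAlg σ).smul_mem c ha.1, fun i x hx =>
    (𝒳 (i + j)).smul_mem c (ha.2 i x hx)⟩

/-- The non-negative degree part `⨁_{j ≥ 0} 𝔰𝔭^j(X)` of `𝔰𝔭(X)`. -/
def spNonneg (𝒳 : ℚ → Submodule ℝ V) (σ : LinearMap.BilinForm ℝ V) :
    Submodule ℝ (Module.End ℝ V) :=
  ⨆ (j : ℚ) (_ : 0 ≤ j), spDeg 𝒳 σ j

/-- `h`, `e`, `ρ` make `X` a nice symplectic `𝔰𝔩₂`-module with `ρ` as the degree `-1`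
component: they satisfy the `𝔰𝔩₂` relations, lie in `𝔰𝔭(X)`, and have degrees `0`, `1`, `-1`. -/
structure IsNiceSl2 (𝒳 : ℚ → Submodule ℝ V) (σ : LinearMap.BilinForm ℝ V)
    (h e ρ : Module.End ℝ V) : Prop where
  h_mem : h ∈ spDeg 𝒳 σ 0
  e_mem : e ∈ spDeg 𝒳 σ 1
  f_mem : ρ ∈ spDeg 𝒳 σ (-1)
  lie_e_f : ⁅e, ρ⁆ = h
  lie_h_e : ⁅h, e⁆ = (2 : ℝ) • e
  lie_h_f : ⁅h, ρ⁆ = -((2 : ℝ) • ρ)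

/-- `𝔩(X)`: the maximal `𝔰𝔩₂`-submodule of `𝔰𝔭(X)` (under the commutator action of `h`, `e`, `ρ`)
concentrated in the non-negative degree part. The sum of all such submodules is again one. -/
def lAlg (𝒳 : ℚ → Submodule ℝ V) (σ : LinearMap.BilinForm ℝ V) (h e ρ : Module.End ℝ V) :
    Submodule ℝ (Module.End ℝ V) :=
  sSup {W | W ≤ spNonneg 𝒳 σ ∧ ∀ A ∈ W, ⁅h, A⁆ ∈ W ∧ ⁅e, A⁆ ∈ W ∧ ⁅ρ, A⁆ ∈ W}

end Graded

/-! ### Skew Young diagrams -/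

/-- A row of a skew Young diagram. Columns are indexed by weights, decreasing by `1` at each step
from left to right; `left` is the weight of the column of the leftmost box, `length` the number of
boxes. -/
structure SkewRow where
  left : ℚ
  length : ℕ

/-- The weight of the column of the rightmost box of a (nonempty) row. -/
def SkewRow.right (r : SkewRow) : ℚ := r.left - ((r.length : ℚ) - 1)

/-- A diagram does not contain two rows such that the leftmost box of one of them lies in the same
column as the rightmost box of the other, or to the right of it. -/
def RowsOverlap (D : List SkewRow) : Prop :=
  ∀ i j : Fin D.length, i ≠ j → ¬ (D.get i).left ≤ (D.get j).right

/-- The types of symplectically indecomposable symbols: `δ_{s,l}`, and `τ_m` with `m = n + 1/2`.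
The sign `ε` in the second case is the sign of the symplectic form on the space of `τ_m`; it can be
normalized by rescaling the form for one summand, but not for several summands at once. -/
inductive SymbolType where
  | delta (s : ℚ) (l : ℕ)
  | tau (n : ℕ) (ε : ℤˣ)

namespace SymbolType

/-- The range of the parameters: for `δ_{s,l}`, either `s` is a non-negative integer and
`0 ≤ l ≤ 2s`, or `s` is a positive half of an odd integer and `0 ≤ l ≤ 2s - 1`. -/
def Admissible : SymbolType → Prop
  | delta s l => (∃ k : ℕ, s = k ∧ (l : ℚ) ≤ 2 * s) ∨
      (∃ k : ℕ, s = k + 1 / 2 ∧ (l : ℚ) ≤ 2 * s - 1)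
  | tau _ _ => True

/-- The rows of the diagram of an indecomposable symbol: `e_s, …, e_{s-l}` above
`f_{l-s}, …, f_{-s}` for `δ_{s,l}`, and `ε_m, …, ε_{-m}` for `τ_m`. -/
def rows : SymbolType → List SkewRow
  | delta s l => [⟨s, l + 1⟩, ⟨l - s, l + 1⟩]
  | tau n _ => [⟨n + 1 / 2, 2 * n + 2⟩]

/-- The boxes of the diagram. For `δ_{s,l}`, `inl k` is the box of `e_{s-k}` and `inr k` that of
`f_{l-s-k}`; for `τ_m`, `k` is the box of `ε_{m-k}`. So `k` is the position in the row. -/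
abbrev Box : SymbolType → Type
  | delta _ l => Fin (l + 1) ⊕ Fin (l + 1)
  | tau n _ => Fin (2 * n + 2)

/-- The weight of the column in which a box lies. -/
def weight : (c : SymbolType) → c.Box → ℚ
  | delta s _, .inl k => s - (k : ℕ)
  | delta s l, .inr k => l - s - (k : ℕ)
  | tau n _, k => n + 1 / 2 - (Fin.val k : ℕ)

/-- The box to the right of a box in its row, if there is one. -/
def next : (c : SymbolType) → c.Box → Option c.Box
  | delta _ l, .inl k => if h : (k : ℕ) + 1 < l + 1 then some (.inl ⟨k + 1, h⟩) else none
  | delta _ l, .inr k => if h : (k : ℕ) + 1 < l + 1 then some (.inr ⟨k + 1, h⟩) else none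
  | tau n _, k => if h : Fin.val k + 1 < 2 * n + 2 then some (⟨Fin.val k + 1, h⟩ : Fin _) else none

/-- The matrix of the symplectic form in the basis given by the boxes: for `δ_{s,l}`,
`σ(e_i, f_{-i}) = (-1)^{s-i}`, and for `τ_m`, `σ(ε_i, ε_{-i}) = ε (-1)^{m-i}`; all other products
(except those obtained by skew symmetry) vanish. -/
def form : (c : SymbolType) → c.Box → c.Box → ℝ
  | delta _ _, .inl _, .inl _ => 0
  | delta _ _, .inr _, .inr _ => 0
  | delta _ l, .inl a, .inr b => if (a : ℕ) + b = l then (-1) ^ (a : ℕ) else 0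
  | delta _ l, .inr b, .inl a => if (a : ℕ) + b = l then -(-1) ^ (a : ℕ) else 0
  | tau n ε, a, b =>
      if Fin.val a + Fin.val b = 2 * n + 1 then ((ε : ℤ) : ℝ) * (-1) ^ (Fin.val a) else 0

end SymbolType

section Tableau

variable {V : Type*} [AddCommGroup V] [Module ℝ V]

/-- `b` is a skew Young tableau of `ρ`: a basis of `X` placed in the boxes of the diagrams of the
indecomposable symbols in the list `C`, through which `ρ` is identified with the direct sum of
these symbols (as endomorphisms of graded symplectic spaces). -/
structure IsSkewTableau (𝒳 : ℚ → Submodule ℝ V) (σ : LinearMap.BilinForm ℝ V)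
    (ρ : Module.End ℝ V) (C : List SymbolType)
    (b : Module.Basis (Σ i : Fin C.length, (C.get i).Box) ℝ V) : Prop where
  weight : ∀ i x, b ⟨i, x⟩ ∈ 𝒳 ((C.get i).weight x)
  form_same : ∀ i x y, σ (b ⟨i, x⟩) (b ⟨i, y⟩) = (C.get i).form x y
  form_ne : ∀ i j x y, i ≠ j → σ (b ⟨i, x⟩) (b ⟨j, y⟩) = 0
  shift : ∀ i x, ρ (b ⟨i, x⟩) = ((C.get i).next x).elim 0 (fun y => b ⟨i, y⟩)

/-- `D` is the skew Young diagram of the symplectic flag symbol `ρ` (determined up to the order of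
the sub-diagrams of the indecomposable components). -/
def IsSkewDiagramOf (𝒳 : ℚ → Submodule ℝ V) (σ : LinearMap.BilinForm ℝ V)
    (ρ : Module.End ℝ V) (D : List SkewRow) : Prop :=
  ∃ C : List SymbolType, (∀ c ∈ C, c.Admissible) ∧
    (∃ b : Module.Basis (Σ i : Fin C.length, (C.get i).Box) ℝ V, IsSkewTableau 𝒳 σ ρ C b) ∧
    D = C.flatMap SymbolType.rows

end Tableau

/-! ### Combinatorics of the boxes -/

namespace SymbolType

/-! Under `𝔰𝔭(X) ≅ S²(X)` the rank one elements are the nonzero multiples of squares `v²`. Both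
sides of the equivalence turn out to say that `ker ρ` contains a nonzero vector concentrated in
non-negative weights.

Suppose `v²` lies in `𝔩(X)` and `u = ρ^p v` is the last nonzero iterate. By the Leibniz rule, `(ad
ρ)^(2p)` sends `v²` to `(2p choose p) u²`, since every other term contains `ρ^m v` with `m > p`.
Stability under `ad ρ` puts `u²` in non-negative degree, so `u` pairs to zero with all positive
weights (`exists_mem_ker_of_rank_one`). Conversely, if `ρ u = 0` with `u` of weight `≥ 0`, then `h`
and `e`, being of degree `0` and `1`, generate from lowest vectors such as `u` an `𝔰𝔩₂`-submodule
`Y` in non-negative weights (`exists_sl2_submodule`). Hence `S²(Y) ⊆ 𝔩(X)`, and it contains `u²`.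

In a tableau, `ker ρ` is spanned by the rightmost boxes. One of these has weight `≥ 0` only in some
`δ_{s,l}` with `l ≤ s`, and this is the diagram condition (`not_rowsOverlap_iff`).

A tableau exists because indecomposable summands can be split off one at a time: the top nonzero
power `ρ^l` on the skew-orthogonal complement of those already found provides the next one
(`exists_indecomposable`). The triple is then the standard one on each row. -/

instance (c : SymbolType) : Fintype c.Box := by
  cases c <;> (dsimp only [Box]; infer_instance)

instance (c : SymbolType) : Nonempty c.Box := by
  cases c
  · exact ⟨.inl 0⟩
  · exact ⟨(0 : Fin _)⟩

/-- The box paired with a given box by the symplectic form. -/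
def dual : (c : SymbolType) → c.Box → c.Box
  | delta _ _, .inl k => .inr k.rev
  | delta _ _, .inr k => .inl k.rev
  | tau _ _, k => Fin.rev k

/-- The common length of the rows of the diagram. -/
def len : SymbolType → ℕ
  | delta _ l => l + 1
  | tau n _ => 2 * n + 2

/-- The position of a box in its row. -/
def pos : (c : SymbolType) → c.Box → ℕ
  | delta _ _, .inl k => k
  | delta _ _, .inr k => k
  | tau _ _, k => Fin.val k

/-- The box to the left of a box in its row, if there is one. -/
def prev (c : SymbolType) (x : c.Box) : Option c.Box := (c.next (c.dual x)).map c.dual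

theorem dual_dual (c : SymbolType) (x : c.Box) : c.dual (c.dual x) = x := by
  cases c with
  | delta s l => rcases x with k | k <;> simp [dual]
  | tau n ε => simp [dual]

theorem pos_dual (c : SymbolType) (x : c.Box) : c.pos (c.dual x) + c.pos x + 1 = c.len := by
  cases c with
  | delta s l => rcases x with k | k <;> simp [dual, pos, len, Fin.val_rev] <;> omega
  | tau n ε =>
    have : Fin.val x < 2 * n + 2 := Fin.isLt x
    simp [dual, pos, len, Fin.val_rev]; omega

theorem weight_dual (c : SymbolType) (x : c.Box) : c.weight (c.dual x) = -c.weight x := by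
  cases c with
  | delta s l =>
    rcases x with k | k
    all_goals
      have hk : (k : ℕ) ≤ l := Nat.lt_succ_iff.mp k.isLt
      simp only [dual, weight, Fin.val_rev]
      rw [show l + 1 - ((k : ℕ) + 1) = l - k by omega, Nat.cast_sub hk]
      ring
  | tau n ε =>
    have hk : Fin.val x ≤ 2 * n + 1 := Nat.lt_succ_iff.mp (Fin.isLt x)
    simp only [dual, weight, Fin.val_rev]
    rw [show 2 * n + 2 - (Fin.val x + 1) = 2 * n + 1 - Fin.val x by omega, Nat.cast_sub hk]
    push_cast
    ring

theorem form_dual_self (c : SymbolType) (x : c.Box) : c.form x (c.dual x) ≠ 0 := by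
  cases c with
  | delta s l =>
    rcases x with k | k
    · have : (k : ℕ) + (l - k) = l := by omega
      simp [dual, form, Fin.val_rev, this]
    · have : l - (k : ℕ) + k = l := by omega
      simp [dual, form, Fin.val_rev, this]
  | tau n ε =>
    have : Fin.val x + (2 * n + 1 - Fin.val x) = 2 * n + 1 := by
      have : Fin.val x < 2 * n + 2 := Fin.isLt x
      omega
    simp [dual, form, Fin.val_rev, this]

theorem form_eq_zero (c : SymbolType) {x y : c.Box} (h : x ≠ c.dual y) : c.form x y = 0 := by
  cases c with
  | delta s l =>
    rcases x with a | a <;> rcases y with b | b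
    · rfl
    · refine if_neg fun hab => h ?_
      simp only [dual, Sum.inl.injEq, Fin.ext_iff, Fin.val_rev]
      omega
    · refine if_neg fun hab => h ?_
      simp only [dual, Sum.inr.injEq, Fin.ext_iff, Fin.val_rev]
      omega
    · rfl
  | tau n ε =>
    refine if_neg fun hab => h (Fin.ext ?_)
    simp only [dual, Fin.val_rev]
    omega

theorem form_ne_zero (c : SymbolType) {x y : c.Box} (h : c.form x y ≠ 0) :
    c.pos x + c.pos y + 1 = c.len := by
  have : x = c.dual y := by
    by_contra h'
    exact h (c.form_eq_zero h')
  rw [this, c.pos_dual]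

theorem next_some (c : SymbolType) {x y : c.Box} (h : c.next x = some y) :
    c.pos y = c.pos x + 1 ∧ c.weight y = c.weight x - 1 ∧
      c.next (c.dual y) = some (c.dual x) := by
  cases c with
  | delta s l =>
    rcases x with k | k
    all_goals
      simp only [next] at h
      split_ifs at h with hk
      obtain rfl := Option.some.inj h
      refine ⟨rfl, ?_, ?_⟩
      · simp only [weight]; push_cast; ring
      · simp only [dual, next, Fin.val_rev]
        rw [dif_pos (by omega)]
        simp only [Option.some.injEq, Sum.inl.injEq, Sum.inr.injEq, Fin.ext_iff, Fin.val_rev]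
        omega
  | tau n ε =>
    simp only [next] at h
    split_ifs at h with hk
    obtain rfl := Option.some.inj h
    refine ⟨rfl, ?_, ?_⟩
    · simp only [weight]; push_cast; ring
    · refine (dif_pos (by simp only [dual, Fin.val_rev]; omega)).trans
        (congrArg some (Fin.ext ?_))
      simp only [dual, Fin.val_rev]
      omega

theorem next_none (c : SymbolType) {x : c.Box} (h : c.next x = none) : c.pos x + 1 = c.len := by
  cases c with
  | delta s l =>
    rcases x with k | k
    all_goals
      simp only [next] at h
      split_ifs at h with hk
      simp only [pos, len]
      omega
  | tau n ε =>
    simp only [next] at h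
    split_ifs at h with hk
    have : Fin.val x < 2 * n + 2 := Fin.isLt x
    simp only [pos, len]
    omega

theorem next_eq_some_iff_prev (c : SymbolType) {x y : c.Box} :
    c.next x = some y ↔ c.prev y = some x := by
  constructor
  · intro h
    rw [prev, (c.next_some h).2.2, Option.map_some, dual_dual]
  · intro h
    rw [prev, Option.map_eq_some_iff] at h
    obtain ⟨z, hz, rfl⟩ := h
    have := (c.next_some hz).2.2
    rwa [dual_dual] at this

theorem prev_none (c : SymbolType) {x : c.Box} (h : c.prev x = none) : c.pos x = 0 := by
  rw [prev, Option.map_eq_none_iff] at h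
  have h1 := c.next_none h
  have h2 := c.pos_dual x
  omega

end SymbolType

/-! ### Partial tableaux -/

section PartialTableau

variable {V : Type*} [AddCommGroup V] [Module ℝ V]

/-- The boxes of the diagrams in a list of symbols. -/
abbrev BoxOf (C : List SymbolType) : Type := Σ i : Fin C.length, (C.get i).Box

/-- The box paired with a given box by the symplectic form. -/
def dualBox {C : List SymbolType} (k : BoxOf C) : BoxOf C := ⟨k.1, (C.get k.1).dual k.2⟩

/-- The weight of the column of a box. -/
def boxWeight {C : List SymbolType} (k : BoxOf C) : ℚ := (C.get k.1).weight k.2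

theorem boxWeight_dualBox {C : List SymbolType} (k : BoxOf C) :
    boxWeight (dualBox k) = -boxWeight k := SymbolType.weight_dual _ _

theorem dualBox_dualBox {C : List SymbolType} (k : BoxOf C) : dualBox (dualBox k) = k := by
  rcases k with ⟨i, x⟩
  simp only [dualBox, SymbolType.dual_dual]

/-- A family of vectors placed in the boxes of diagrams which satisfies the relations of a skew
Young tableau, but need not span the space. -/
structure IsPartialTableau (𝒳 : ℚ → Submodule ℝ V) (σ : LinearMap.BilinForm ℝ V)
    (ρ : Module.End ℝ V) (C : List SymbolType) (b : BoxOf C → V) : Prop where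
  weight : ∀ i x, b ⟨i, x⟩ ∈ 𝒳 ((C.get i).weight x)
  form_same : ∀ i x y, σ (b ⟨i, x⟩) (b ⟨i, y⟩) = (C.get i).form x y
  form_ne : ∀ i j x y, i ≠ j → σ (b ⟨i, x⟩) (b ⟨j, y⟩) = 0
  shift : ∀ i x, ρ (b ⟨i, x⟩) = ((C.get i).next x).elim 0 (fun y => b ⟨i, y⟩)

theorem IsSkewTableau.isPartialTableau {𝒳 : ℚ → Submodule ℝ V} {σ : LinearMap.BilinForm ℝ V}
    {ρ : Module.End ℝ V} {C : List SymbolType} {b : Module.Basis (BoxOf C) ℝ V}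
    (hb : IsSkewTableau 𝒳 σ ρ C b) : IsPartialTableau 𝒳 σ ρ C b :=
  ⟨hb.weight, hb.form_same, hb.form_ne, hb.shift⟩

namespace IsPartialTableau

variable {𝒳 : ℚ → Submodule ℝ V} {σ : LinearMap.BilinForm ℝ V} {ρ : Module.End ℝ V}
  {C : List SymbolType} {b : BoxOf C → V}

theorem apply_dualBox_self (hb : IsPartialTableau 𝒳 σ ρ C b) (k : BoxOf C) :
    σ (b k) (b (dualBox k)) ≠ 0 := by
  rcases k with ⟨i, x⟩
  rw [dualBox, hb.form_same]
  exact SymbolType.form_dual_self _ _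

theorem apply_dualBox_of_ne (hb : IsPartialTableau 𝒳 σ ρ C b) {k m : BoxOf C} (h : m ≠ k) :
    σ (b m) (b (dualBox k)) = 0 := by
  rcases k with ⟨i, x⟩
  rcases m with ⟨j, y⟩
  by_cases hij : j = i
  · subst hij
    rw [dualBox, hb.form_same]
    refine SymbolType.form_eq_zero _ fun h' => h ?_
    rw [h', SymbolType.dual_dual]
  · exact hb.form_ne _ _ _ _ hij

theorem apply_sum_dualBox (hb : IsPartialTableau 𝒳 σ ρ C b) (c : BoxOf C → ℝ) (k : BoxOf C) :
    σ (∑ m, c m • b m) (b (dualBox k)) = c k * σ (b k) (b (dualBox k)) := by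
  classical
  rw [map_sum, LinearMap.sum_apply, Finset.sum_eq_single k]
  · simp
  · intro m _ hm
    simp [hb.apply_dualBox_of_ne hm]
  · simp

/-- Each vector pairs nontrivially with the vector in its dual box, and no other vector of the
family does, so pairing with dual boxes reads off coefficients. -/
theorem linearIndependent (hb : IsPartialTableau 𝒳 σ ρ C b) : LinearIndependent ℝ b := by
  rw [Fintype.linearIndependent_iff]
  intro c hc k
  have h := hb.apply_sum_dualBox c k
  rw [hc, map_zero, LinearMap.zero_apply] at h
  exact (mul_eq_zero.mp h.symm).resolve_right (hb.apply_dualBox_self k)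

/-- The projection to the skew-orthogonal complement of a partial tableau. -/
noncomputable def proj (_ : IsPartialTableau 𝒳 σ ρ C b) : Module.End ℝ V :=
  LinearMap.id - ∑ k, ((σ (b k) (b (dualBox k)))⁻¹ • σ.flip (b (dualBox k))).smulRight (b k)

theorem proj_apply (hb : IsPartialTableau 𝒳 σ ρ C b) (v : V) :
    hb.proj v = v - ∑ k, ((σ (b k) (b (dualBox k)))⁻¹ * σ v (b (dualBox k))) • b k := by
  simp [proj, LinearMap.sum_apply]

theorem apply_proj (hb : IsPartialTableau 𝒳 σ ρ C b) (v : V) (k : BoxOf C) :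
    σ (hb.proj v) (b k) = 0 := by
  rw [← dualBox_dualBox k, proj_apply, map_sub, LinearMap.sub_apply, hb.apply_sum_dualBox,
    mul_comm (_⁻¹), mul_assoc, inv_mul_cancel₀ (hb.apply_dualBox_self _), mul_one, sub_self]

theorem proj_of_orthogonal (hb : IsPartialTableau 𝒳 σ ρ C b) {v : V} (hv : ∀ k, σ v (b k) = 0) :
    hb.proj v = v := by
  simp [proj_apply, hv]

theorem apply_eq_apply_proj (hb : IsPartialTableau 𝒳 σ ρ C b) {v : V}
    (hv : ∀ k, σ v (b k) = 0) (w : V) : σ v (hb.proj w) = σ v w := by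
  simp [proj_apply, hv, map_sum]

theorem proj_mem (hX : IsGradedSymplectic 𝒳 σ) (hb : IsPartialTableau 𝒳 σ ρ C b) {i : ℚ} {v : V}
    (hv : v ∈ 𝒳 i) : hb.proj v ∈ 𝒳 i := by
  rw [proj_apply]
  refine (𝒳 i).sub_mem hv ((𝒳 i).sum_mem fun k _ => ?_)
  by_cases hk : boxWeight k = i
  · exact (𝒳 i).smul_mem _ (hk ▸ hb.weight k.1 k.2)
  · have : σ v (b (dualBox k)) = 0 := by
      refine hX.orthogonal i (boxWeight (dualBox k)) ?_ v hv _ (hb.weight _ _)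
      rw [boxWeight_dualBox]
      intro h
      exact hk (by linarith)
    simp [this]

theorem orthogonal_map (hb : IsPartialTableau 𝒳 σ ρ C b)
    (hρ : ∀ x y, σ (ρ x) y = -σ x (ρ y)) {v : V} (hv : ∀ k, σ v (b k) = 0) (k : BoxOf C) :
    σ (ρ v) (b k) = 0 := by
  rcases k with ⟨i, x⟩
  rw [hρ, hb.shift]
  rcases (C.get i).next x with _ | y
  · simp
  · simp [hv]

theorem cons (hX : IsGradedSymplectic 𝒳 σ) (hb : IsPartialTableau 𝒳 σ ρ C b) (c : SymbolType)
    (φ : c.Box → V)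
    (hφ : ∀ x k, σ (φ x) (b k) = 0) (hw : ∀ x, φ x ∈ 𝒳 (c.weight x))
    (hf : ∀ x y, σ (φ x) (φ y) = c.form x y)
    (hs : ∀ x, ρ (φ x) = (c.next x).elim 0 φ) :
    ∃ b' : BoxOf (c :: C) → V, IsPartialTableau 𝒳 σ ρ (c :: C) b' := by
  let β : ∀ i : Fin (C.length + 1), ((c :: C).get i).Box → V :=
    Fin.cases φ (fun i x => b ⟨i, x⟩)
  refine ⟨fun k => β k.1 k.2, ?_, ?_, ?_, ?_⟩
  · exact Fin.cases hw fun i => hb.weight i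
  · exact Fin.cases hf fun i => hb.form_same i
  · refine Fin.cases (Fin.cases (fun _ _ h => (h rfl).elim) fun j x y _ => hφ x ⟨j, y⟩)
      fun i => Fin.cases (fun x y _ => ?_)
        fun j x y h => hb.form_ne i j x y fun h' => h (by rw [h'])
    rw [← hX.alt.neg_eq]
    exact neg_eq_zero.mpr (hφ y ⟨i, x⟩)
  · exact Fin.cases hs fun i => hb.shift i

end IsPartialTableau

end PartialTableau

/-! ### Homogeneous elements -/

section Homogeneous

variable {V : Type*} [AddCommGroup V] [Module ℝ V]
  {𝒳 : ℚ → Submodule ℝ V} {σ : LinearMap.BilinForm ℝ V} {ρ : Module.End ℝ V}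

theorem IsGradedSymplectic.induction (hX : IsGradedSymplectic 𝒳 σ) {p : V → Prop}
    (mem : ∀ i, ∀ x ∈ 𝒳 i, p x) (zero : p 0) (add : ∀ x y, p x → p y → p (x + y)) (x : V) : p x :=
  Submodule.iSup_induction 𝒳 (motive := p) (x := x)
    (by rw [hX.internal.submodule_iSup_eq_top]; trivial) mem zero add

theorem IsGradedSymplectic.exists_homogeneous_ne_zero (hX : IsGradedSymplectic 𝒳 σ) {W : Type*}
    [AddCommGroup W] [Module ℝ W] {f : V →ₗ[ℝ] W} (hf : f ≠ 0) : ∃ i, ∃ x ∈ 𝒳 i, f x ≠ 0 := by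
  by_contra! h
  refine hf (LinearMap.ext fun x => ?_)
  induction x using hX.induction with
  | mem i x hx => exact h i x hx
  | zero => simp
  | add x y hx hy => rw [map_add, hx, hy]; simp

theorem IsGradedSymplectic.apply_ne_zero (hX : IsGradedSymplectic 𝒳 σ) {x : V} (hx : x ≠ 0) :
    σ x ≠ 0 := fun h => hx (hX.nondegenerate.1 x fun y => by rw [h, LinearMap.zero_apply])

/-- The conformal factor contributes nothing. On weights with `i + j = 0` the left side of the
conformal identity pairs weights of sum `-1`, so it vanishes; on other weights `σ` itself vanishes.
-/
theorem IsSymplecticFlagSymbol.skew (hX : IsGradedSymplectic 𝒳 σ)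
    (hρ : IsSymplecticFlagSymbol 𝒳 σ ρ) (x y : V) : σ (ρ x) y = -σ x (ρ y) := by
  obtain ⟨c, hc⟩ := hρ.conformal
  have key : ∀ x y, c * σ x y = 0 := by
    intro x y
    induction x using hX.induction with
    | zero => simp
    | add x x' hx hx' => rw [map_add, LinearMap.add_apply, mul_add, hx, hx', add_zero]
    | mem i x hx =>
      induction y using hX.induction with
      | zero => simp
      | add y y' hy hy' => rw [map_add, mul_add, hy, hy', add_zero]
      | mem j y hy =>
        by_cases hij : i + j = 0
        · rw [← hc, hX.orthogonal (i + -1) j (by intro h; linarith) _ (hρ.degree i x hx) y hy,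
            hX.orthogonal i (j + -1) (by intro h; linarith) x hx _ (hρ.degree j y hy), add_zero]
        · rw [hX.orthogonal i j hij x hx y hy, mul_zero]
  have := hc x y
  rw [key] at this
  linarith

theorem HasDegree.pow_mem (hρ : HasDegree 𝒳 (-1) ρ) (n : ℕ) {i : ℚ} {x : V} (hx : x ∈ 𝒳 i) :
    (ρ ^ n) x ∈ 𝒳 (i - n) := by
  induction n with
  | zero => simpa using hx
  | succ n ih =>
    have := hρ _ _ ih
    rw [pow_succ', Module.End.mul_apply]
    convert this using 2
    push_cast
    ring

/-- Only finitely many weight spaces are nonzero, and `ρ` lowers the weight. -/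
theorem HasDegree.isNilpotent [FiniteDimensional ℝ V] (hX : IsGradedSymplectic 𝒳 σ)
    (hρ : HasDegree 𝒳 (-1) ρ) : IsNilpotent ρ := by
  have hfin : {i | 𝒳 i ≠ ⊥}.Finite :=
    WellFoundedGT.finite_ne_bot_of_iSupIndep hX.internal.submodule_iSupIndep
  rw [Module.End.isNilpotent_iff_of_finite]
  intro x
  suffices x ∈ ρ.maxGenEigenspace 0 by
    simpa [Module.End.mem_maxGenEigenspace] using this
  induction x using hX.induction with
  | zero => exact Submodule.zero_mem _
  | add x y hx hy => exact Submodule.add_mem _ hx hy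
  | mem i x hx =>
    by_contra hne
    have hne : ∀ n : ℕ, (ρ ^ n) x ≠ 0 := by
      simpa [Module.End.mem_maxGenEigenspace] using hne
    refine Set.infinite_of_injective_forall_mem (f := fun n : ℕ => i - n) ?_ ?_ hfin
    · intro m n h
      exact_mod_cast sub_right_injective h
    · intro n hbot
      have := hρ.pow_mem n hx
      rw [hbot] at this
      exact hne n this

theorem skew_pow (hρ : ∀ x y, σ (ρ x) y = -σ x (ρ y)) (n : ℕ) (x y : V) :
    σ ((ρ ^ n) x) y = (-1) ^ n * σ x ((ρ ^ n) y) := by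
  induction n generalizing x y with
  | zero => simp
  | succ n ih =>
    have h : (ρ ^ (n + 1)) y = ρ ((ρ ^ n) y) := by rw [pow_succ', Module.End.mul_apply]
    rw [h, pow_succ ρ, Module.End.mul_apply, ih, hρ, pow_succ]
    ring

theorem apply_pow_pow (hρ : ∀ x y, σ (ρ x) y = -σ x (ρ y)) (m n : ℕ) (x y : V) :
    σ ((ρ ^ m) x) ((ρ ^ n) y) = (-1) ^ n * σ ((ρ ^ (m + n)) x) y := by
  rw [add_comm m n, pow_add ρ n m, Module.End.mul_apply, skew_pow hρ n, ← mul_assoc, ← mul_pow]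
  simp

end Homogeneous

/-! ### Existence of skew Young tableaux -/

section Existence

variable {V : Type*} [AddCommGroup V] [Module ℝ V]
  {𝒳 : ℚ → Submodule ℝ V} {σ : LinearMap.BilinForm ℝ V} {ρ : Module.End ℝ V}

/-- For even `n` the form `σ (ρ^n x) y` is skew-symmetric; for odd `n` it is symmetric, which is
where the obstruction to isotropy and the symbols `τ_m` come from. -/
theorem apply_pow_self_of_even (hX : IsGradedSymplectic 𝒳 σ) (hρ : ∀ x y, σ (ρ x) y = -σ x (ρ y))
    {n : ℕ} (hn : Even n) (x : V) : σ ((ρ ^ n) x) x = 0 := by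
  have h1 := skew_pow hρ n x x
  have h2 := hX.alt.neg_eq x ((ρ ^ n) x)
  rw [hn.neg_one_pow, one_mul] at h1
  linarith

theorem pow_eq_zero_of_lt {l n : ℕ} {x : V} (hx : (ρ ^ (l + 1)) x = 0) (hn : l < n) :
    (ρ ^ n) x = 0 := by
  obtain ⟨k, rfl⟩ := Nat.exists_eq_add_of_le' (Nat.succ_le_of_lt hn)
  rw [pow_add, Module.End.mul_apply, hx, map_zero]

theorem pow_mem_of_invariant {Q : Submodule ℝ V} (hQ : ∀ v ∈ Q, ρ v ∈ Q) {x : V} (hx : x ∈ Q)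
    (n : ℕ) : (ρ ^ n) x ∈ Q := by
  induction n with
  | zero => simpa using hx
  | succ n ih =>
    rw [pow_succ', Module.End.mul_apply]
    exact hQ _ ih

/-- By parity and weights, the only self-pairing of the string of `y` that can survive is at an odd
`n = q = 2(l - a)`. It is removed by adding to `y` a multiple of `ρ^(l-q) x`, which has the same
weight as `y`. This requires `q < l`; the case `q = l` is the excluded one, left to `τ_m`. -/
theorem exists_isotropic_dual_string (hX : IsGradedSymplectic 𝒳 σ)
    (hρ : ∀ x y, σ (ρ x) y = -σ x (ρ y)) (hd : HasDegree 𝒳 (-1) ρ)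
    {Q : Submodule ℝ V} (hQ : ∀ v ∈ Q, ρ v ∈ Q) {l : ℕ}
    (hl : ∀ v ∈ Q, (ρ ^ (l + 1)) v = 0) {a : ℚ} (hal : (l : ℚ) ≤ 2 * a)
    (hodd : ¬ (Odd l ∧ 2 * a = l)) {x y : V} (hxQ : x ∈ Q) (hyQ : y ∈ Q) (hx : x ∈ 𝒳 a)
    (hy : y ∈ 𝒳 (l - a)) (hxy : σ ((ρ ^ l) x) y ≠ 0) :
    ∃ y' ∈ Q, y' ∈ 𝒳 (l - a) ∧ σ ((ρ ^ l) x) y' ≠ 0 ∧ ∀ n : ℕ, σ ((ρ ^ n) y') y' = 0 := by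
  have weight_ne : ∀ z ∈ 𝒳 (l - a), ∀ n : ℕ, (n : ℚ) ≠ 2 * (l - a) → σ ((ρ ^ n) z) z = 0 := by
    intro z hz n hn
    refine hX.orthogonal _ _ ?_ _ (hd.pow_mem n hz) _ hz
    intro h
    exact hn (by linarith)
  by_cases hq : ∃ q : ℕ, Odd q ∧ (q : ℚ) = 2 * (l - a)
  · obtain ⟨q, hq, hqa⟩ := hq
    have hql : q < l := by
      have h1 : (q : ℚ) ≤ l := by linarith
      refine lt_of_le_of_ne (by exact_mod_cast h1) ?_
      rintro rfl
      exact hodd ⟨hq, by linarith⟩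
    obtain ⟨i, rfl⟩ := Nat.exists_eq_add_of_lt hql
    -- Root of `σ (ρ^q y) y + 2 t σ (ρ^l x) y = 0`. The quadratic term in `t` vanishes because it
    -- involves a power of `ρ` above `l`.
    set t : ℝ := -σ ((ρ ^ q) y) y / (2 * σ ((ρ ^ (q + i + 1)) x) y) with ht
    have hiw : (ρ ^ (i + 1)) x ∈ 𝒳 (↑(q + i + 1) - a) := by
      have := hd.pow_mem (i + 1) hx
      convert this using 2
      push_cast at hqa ⊢
      linarith
    have hy' : y + t • (ρ ^ (i + 1)) x ∈ 𝒳 (↑(q + i + 1) - a) :=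
      (𝒳 _).add_mem hy ((𝒳 _).smul_mem t hiw)
    refine ⟨y + t • (ρ ^ (i + 1)) x,
      Q.add_mem hyQ (Q.smul_mem t (pow_mem_of_invariant hQ hxQ _)), hy', ?_, fun n => ?_⟩
    · rw [map_add, map_smul, apply_pow_pow hρ,
        pow_eq_zero_of_lt (hl x hxQ) (by omega : q + i + 1 < q + i + 1 + (i + 1))]
      simpa using hxy
    · by_cases hn : n = q
      · subst hn
        have h1 : σ ((ρ ^ (n + (i + 1))) x) y = σ ((ρ ^ (n + i + 1)) x) y := by rw [add_assoc]
        have h2 : σ ((ρ ^ n) y) ((ρ ^ (i + 1)) x) = σ ((ρ ^ (n + i + 1)) x) y := by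
          rw [← hX.alt.neg_eq, apply_pow_pow hρ, hq.neg_one_pow, add_comm (i + 1), h1]
          ring
        have h3 : σ ((ρ ^ (n + (i + 1))) x) ((ρ ^ (i + 1)) x) = 0 := by
          rw [apply_pow_pow hρ, pow_eq_zero_of_lt (hl x hxQ)
            (by omega : n + i + 1 < n + (i + 1) + (i + 1))]
          simp
        simp only [map_add, map_smul, LinearMap.add_apply, LinearMap.smul_apply, smul_eq_mul]
        rw [← Module.End.mul_apply, ← pow_add, h1, h2, h3, ht]
        field_simp
        ring
      · exact weight_ne _ hy' n fun h => hn (by exact_mod_cast h.trans hqa.symm)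
  · refine ⟨y, hyQ, hy, hxy, fun n => ?_⟩
    rcases Nat.even_or_odd n with hn | hn
    · exact apply_pow_self_of_even hX hρ hn y
    · exact weight_ne y hy n fun h => hq ⟨n, hn, h⟩

theorem exists_delta (hX : IsGradedSymplectic 𝒳 σ)
    (hρ : ∀ x y, σ (ρ x) y = -σ x (ρ y)) (hd : HasDegree 𝒳 (-1) ρ)
    {Q : Submodule ℝ V} (hQ : ∀ v ∈ Q, ρ v ∈ Q) {l : ℕ}
    (hl : ∀ v ∈ Q, (ρ ^ (l + 1)) v = 0) {a : ℚ} (hal : (l : ℚ) ≤ 2 * a)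
    (hodd : ¬ (Odd l ∧ 2 * a = l)) {x y : V} (hxQ : x ∈ Q) (hyQ : y ∈ Q) (hx : x ∈ 𝒳 a)
    (hy : y ∈ 𝒳 (l - a)) (hxy : σ ((ρ ^ l) x) y ≠ 0) :
    ∃ c : SymbolType, c.Admissible ∧ ∃ φ : c.Box → V, (∀ k, φ k ∈ Q) ∧
      (∀ k, φ k ∈ 𝒳 (c.weight k)) ∧ (∀ k m, σ (φ k) (φ m) = c.form k m) ∧
      ∀ k, ρ (φ k) = (c.next k).elim 0 φ := by
  obtain ⟨y₁, hy₁Q, hy₁, hxy₁, hyy₁⟩ :=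
    exists_isotropic_dual_string hX hρ hd hQ hl hal hodd hxQ hyQ hx hy hxy
  -- The normalization `(-1)^l` makes `σ (ρ^m x) (ρ^n z) = (-1)^n (-1)^l = (-1)^m` when `m + n = l`,
  -- as `form` prescribes.
  obtain ⟨z, hzQ, hz, hxz, hzz⟩ : ∃ z ∈ Q, z ∈ 𝒳 (l - a) ∧ σ ((ρ ^ l) x) z = (-1) ^ l ∧
      ∀ n : ℕ, σ ((ρ ^ n) z) z = 0 := by
    refine ⟨((-1) ^ l / σ ((ρ ^ l) x) y₁) • y₁, Q.smul_mem _ hy₁Q, (𝒳 _).smul_mem _ hy₁, ?_, ?_⟩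
    · rw [map_smul, smul_eq_mul, div_mul_cancel₀ _ hxy₁]
    · intro n
      simp [hyy₁]
  have hxx : ∀ n : ℕ, σ ((ρ ^ n) x) x = 0 := by
    intro n
    rcases lt_or_ge l n with hn | hn
    · rw [pow_eq_zero_of_lt (hl x hxQ) hn]; simp
    · rcases Nat.even_or_odd n with hn' | hn'
      · exact apply_pow_self_of_even hX hρ hn' x
      -- A nonzero pairing needs `n = 2a`; with `n ≤ l ≤ 2a` this forces `n = l = 2a` odd, which is
      -- excluded.
      · refine hX.orthogonal _ _ ?_ _ (hd.pow_mem n hx) _ hx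
        intro h
        have h1 : (n : ℚ) ≤ l := by exact_mod_cast hn
        have h2 : (n : ℚ) = l := by linarith
        have h3 : n = l := by exact_mod_cast h2
        exact hodd ⟨h3 ▸ hn', by linarith⟩
  have hform : ∀ m n : ℕ, σ ((ρ ^ m) x) ((ρ ^ n) z) = if m + n = l then (-1) ^ m else 0 := by
    intro m n
    split_ifs with h
    · rw [apply_pow_pow hρ, h, hxz, ← h, pow_add, mul_comm ((-1 : ℝ) ^ m), ← mul_assoc, ← mul_pow]
      simp
    · refine hX.orthogonal _ _ ?_ _ (hd.pow_mem m hx) _ (hd.pow_mem n hz)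
      intro h'
      have h2 : ((m + n : ℕ) : ℚ) = l := by push_cast; linarith
      exact h (by exact_mod_cast h2)
  have hx0 : x ≠ 0 := by
    rintro rfl
    simp at hxy
  obtain ⟨n, hn⟩ : ∃ n : ℤ, a = n / 2 := by
    by_contra h
    have := hX.halfInt a h
    rw [this] at hx
    exact hx0 hx
  refine ⟨.delta a l, ?_, Sum.elim (fun k => (ρ ^ (k : ℕ)) x) (fun k => (ρ ^ (k : ℕ)) z),
    ?_, ?_, ?_, ?_⟩
  · subst hn
    have hn0 : 0 ≤ n := by
      have : (0 : ℚ) ≤ n := by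
        have : (0 : ℚ) ≤ l := l.cast_nonneg
        linarith
      exact_mod_cast this
    lift n to ℕ using hn0
    rcases Nat.even_or_odd' n with ⟨k, rfl | rfl⟩
    · left
      exact ⟨k, by push_cast; ring, hal⟩
    · right
      refine ⟨k, by push_cast; ring, ?_⟩
      have h1 : l ≤ 2 * k + 1 := by
        have : (l : ℚ) ≤ ((2 * k + 1 : ℕ) : ℚ) := by push_cast at hal ⊢; linarith
        exact_mod_cast this
      have h2 : l ≠ 2 * k + 1 := by
        rintro rfl
        exact hodd ⟨⟨k, rfl⟩, by push_cast; ring⟩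
      have h3 : l ≤ 2 * k := by omega
      have h4 : (l : ℚ) ≤ ((2 * k : ℕ) : ℚ) := by exact_mod_cast h3
      push_cast at h4 ⊢
      linarith
  · rintro (k | k)
    · exact pow_mem_of_invariant hQ hxQ _
    · exact pow_mem_of_invariant hQ hzQ _
  · rintro (k | k)
    · exact hd.pow_mem k hx
    · exact hd.pow_mem k hz
  · rintro (k | k) (m | m)
    · simp only [Sum.elim_inl, SymbolType.form]
      rw [apply_pow_pow hρ, hxx, mul_zero]
    · exact hform k m
    · simp only [Sum.elim_inl, Sum.elim_inr, SymbolType.form]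
      rw [← hX.alt.neg_eq, hform]
      split_ifs <;> simp
    · simp only [Sum.elim_inr, SymbolType.form]
      rw [apply_pow_pow hρ, hzz, mul_zero]
  · rintro (k | k)
    all_goals
      simp only [Sum.elim_inl, Sum.elim_inr, SymbolType.next]
      rw [← Module.End.mul_apply, ← pow_succ']
      split_ifs with h
      · rfl
      · exact pow_eq_zero_of_lt (hl _ ‹_›) (by omega)

theorem exists_tau (hX : IsGradedSymplectic 𝒳 σ)
    (hρ : ∀ x y, σ (ρ x) y = -σ x (ρ y)) (hd : HasDegree 𝒳 (-1) ρ)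
    {Q : Submodule ℝ V} (hQ : ∀ v ∈ Q, ρ v ∈ Q) {l : ℕ}
    (hl : ∀ v ∈ Q, (ρ ^ (l + 1)) v = 0) (hodd : Odd l) {z : V} (hzQ : z ∈ Q)
    (hz : z ∈ 𝒳 (l / 2)) (hzz : σ ((ρ ^ l) z) z ≠ 0) :
    ∃ c : SymbolType, c.Admissible ∧ ∃ φ : c.Box → V, (∀ k, φ k ∈ Q) ∧
      (∀ k, φ k ∈ 𝒳 (c.weight k)) ∧ (∀ k m, σ (φ k) (φ m) = c.form k m) ∧
      ∀ k, ρ (φ k) = (c.next k).elim 0 φ := by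
  -- Real rescaling changes `σ (ρ^l z) z` only by positive squares, so its sign survives as `ε`. The
  -- minus sign appears because `l` is odd: `σ w (ρ^l w) = -σ (ρ^l w) w = ε`.
  obtain ⟨ε, w, hwQ, hw, hww⟩ : ∃ ε : ℤˣ, ∃ w ∈ Q, w ∈ 𝒳 (l / 2) ∧
      σ ((ρ ^ l) w) w = -((ε : ℤ) : ℝ) := by
    obtain ⟨ε, hε⟩ : ∃ ε : ℤˣ, 0 < -((ε : ℤ) : ℝ) * σ ((ρ ^ l) z) z := by
      rcases lt_or_gt_of_ne hzz with h | h
      · exact ⟨1, by simpa using h⟩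
      · exact ⟨-1, by simpa using h⟩
    have hε2 : ((ε : ℤ) : ℝ) * ((ε : ℤ) : ℝ) = 1 := by
      rcases Int.units_eq_one_or ε with rfl | rfl <;> simp
    set r := -((ε : ℤ) : ℝ) * σ ((ρ ^ l) z) z with hr
    refine ⟨ε, (√r)⁻¹ • z, Q.smul_mem _ hzQ, (𝒳 _).smul_mem _ hz, ?_⟩
    have h1 : (√r)⁻¹ * (√r)⁻¹ = r⁻¹ := by rw [← mul_inv, Real.mul_self_sqrt hε.le]
    have h2 : σ ((ρ ^ l) z) z = -((ε : ℤ) : ℝ) * r := by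
      rw [hr]
      linear_combination (-σ ((ρ ^ l) z) z) * hε2
    simp only [map_smul, LinearMap.smul_apply, smul_eq_mul]
    rw [← mul_assoc, h1, h2, mul_comm, mul_assoc, mul_inv_cancel₀ hε.ne', mul_one]
  obtain ⟨n, rfl⟩ := hodd
  refine ⟨.tau n ε, trivial, fun k => (ρ ^ Fin.val k) w, ?_, ?_, ?_, ?_⟩
  · exact fun k => pow_mem_of_invariant hQ hwQ _
  · intro k
    have := hd.pow_mem (Fin.val k) hw
    convert this using 2
    simp only [SymbolType.weight]
    push_cast
    ring
  · intro k m
    simp only [SymbolType.form]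
    split_ifs with h
    · have hs : (-1 : ℝ) ^ Fin.val m = -(-1) ^ Fin.val k := by
        have h1 : (-1 : ℝ) ^ Fin.val k * (-1) ^ Fin.val m = -1 := by
          rw [← pow_add, h, Odd.neg_one_pow ⟨n, rfl⟩]
        have h2 : (-1 : ℝ) ^ Fin.val k * (-1) ^ Fin.val k = 1 := by
          rw [← mul_pow]; simp
        linear_combination (-1 : ℝ) ^ Fin.val k * h1 - (-1 : ℝ) ^ Fin.val m * h2
      rw [apply_pow_pow hρ, h, hww, hs]
      ring
    · refine hX.orthogonal _ _ ?_ _ (hd.pow_mem _ hw) _ (hd.pow_mem _ hw)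
      intro h'
      have h2 : ((Fin.val k + Fin.val m : ℕ) : ℚ) = (2 * n + 1 : ℕ) := by push_cast at h' ⊢; linarith
      exact h (by exact_mod_cast h2)
  · intro k
    simp only [SymbolType.next]
    rw [← Module.End.mul_apply, ← pow_succ']
    split_ifs with h
    · rfl
    · exact pow_eq_zero_of_lt (hl _ hwQ) (by omega)

/-- If `l` is odd and both weights equal `l/2`, then `σ (ρ^l x) y` is a symmetric form on that
weight space, and by polarization it is nonzero on one of `x`, `y`, `x + y`: this yields `τ_m`.
Otherwise `x` and `y`, swapped if necessary so that the first weight is at least `l/2`, generate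
some `δ_{s,l}`. -/
theorem exists_indecomposable (hX : IsGradedSymplectic 𝒳 σ)
    (hρ : ∀ x y, σ (ρ x) y = -σ x (ρ y)) (hd : HasDegree 𝒳 (-1) ρ)
    {Q : Submodule ℝ V} (hQ : ∀ v ∈ Q, ρ v ∈ Q) {l : ℕ}
    (hl : ∀ v ∈ Q, (ρ ^ (l + 1)) v = 0) {a : ℚ} {x y : V} (hxQ : x ∈ Q) (hyQ : y ∈ Q)
    (hx : x ∈ 𝒳 a) (hy : y ∈ 𝒳 (l - a)) (hxy : σ ((ρ ^ l) x) y ≠ 0) :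
    ∃ c : SymbolType, c.Admissible ∧ ∃ φ : c.Box → V, (∀ k, φ k ∈ Q) ∧
      (∀ k, φ k ∈ 𝒳 (c.weight k)) ∧ (∀ k m, σ (φ k) (φ m) = c.form k m) ∧
      ∀ k, ρ (φ k) = (c.next k).elim 0 φ := by
  have hyx : σ ((ρ ^ l) y) x = -(-1) ^ l * σ ((ρ ^ l) x) y := by
    rw [skew_pow hρ, ← hX.alt.neg_eq]
    ring
  by_cases hodd : Odd l ∧ 2 * a = l
  · obtain ⟨hodd, ha⟩ := hodd
    have hx' : x ∈ 𝒳 (l / 2) := by rwa [← ha, mul_div_cancel_left₀ _ two_ne_zero]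
    have hy' : y ∈ 𝒳 (l / 2) := by
      convert hy using 2
      linarith
    rw [hodd.neg_one_pow, neg_neg, one_mul] at hyx
    by_cases h1 : σ ((ρ ^ l) x) x = 0
    · by_cases h2 : σ ((ρ ^ l) y) y = 0
      · refine exists_tau hX hρ hd hQ hl hodd (Q.add_mem hxQ hyQ) ((𝒳 _).add_mem hx' hy') ?_
        simp only [map_add, LinearMap.add_apply, h1, h2, hyx]
        intro h
        exact hxy (by linarith)
      · exact exists_tau hX hρ hd hQ hl hodd hyQ hy' h2
    · exact exists_tau hX hρ hd hQ hl hodd hxQ hx' h1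
  · rcases le_total (l : ℚ) (2 * a) with hal | hal
    · exact exists_delta hX hρ hd hQ hl hal hodd hxQ hyQ hx hy hxy
    · refine exists_delta hX hρ hd hQ hl (a := l - a) (by linarith) ?_ hyQ hxQ hy
        (by rwa [sub_sub_cancel]) (by rw [hyx]; exact mul_ne_zero (by simp) hxy)
      rintro ⟨h1, h2⟩
      exact hodd ⟨h1, by linarith⟩

theorem IsPartialTableau.exists_cons [FiniteDimensional ℝ V] (hX : IsGradedSymplectic 𝒳 σ)
    (hρ : ∀ x y, σ (ρ x) y = -σ x (ρ y)) (hd : HasDegree 𝒳 (-1) ρ) {C : List SymbolType}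
    {b : BoxOf C → V} (hb : IsPartialTableau 𝒳 σ ρ C b) (hspan : Submodule.span ℝ (Set.range b) ≠ ⊤) :
    ∃ c : SymbolType, c.Admissible ∧ ∃ b', IsPartialTableau 𝒳 σ ρ (c :: C) b' := by
  classical
  -- `Q` is the skew-orthogonal complement of the tableau. It is `ρ`-invariant, and `hb.proj` maps
  -- onto it preserving weights, so homogeneous vectors of `Q` can be obtained by projecting.
  let Q : Submodule ℝ V := ⨅ k, LinearMap.ker (σ.flip (b k))
  have memQ : ∀ v, v ∈ Q ↔ ∀ k, σ v (b k) = 0 := by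
    intro v
    simp [Q, Submodule.mem_iInf]
  have hQ : ∀ v ∈ Q, ρ v ∈ Q := by
    intro v hv
    rw [memQ] at hv ⊢
    exact hb.orthogonal_map hρ hv
  have hproj : ∀ v, hb.proj v ∈ Q := fun v => (memQ _).2 (hb.apply_proj v)
  obtain ⟨v₀, hv₀, hv₀'⟩ : ∃ v ∈ Q, v ≠ 0 := by
    by_contra! h
    refine hspan (eq_top_iff.2 fun v _ => ?_)
    have h1 := h _ (hproj v)
    rw [hb.proj_apply, sub_eq_zero] at h1
    rw [h1]
    exact Submodule.sum_mem _ fun k _ => Submodule.smul_mem _ _ (Submodule.subset_span ⟨k, rfl⟩)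
  have hex : ∃ n : ℕ, ∀ v ∈ Q, (ρ ^ n) v = 0 := by
    obtain ⟨n, hn⟩ := hd.isNilpotent hX
    exact ⟨n, fun v _ => by rw [hn, LinearMap.zero_apply]⟩
  obtain ⟨l, hl⟩ : ∃ l, Nat.find hex = l + 1 := by
    refine Nat.exists_eq_succ_of_ne_zero fun h0 => hv₀' ?_
    have := Nat.find_spec hex v₀ hv₀
    rw [h0] at this
    simpa using this
  have hnil := Nat.find_spec hex
  rw [hl] at hnil
  have hmin := Nat.find_min hex (m := l) (by omega)
  push Not at hmin
  obtain ⟨v, hvQ, hv⟩ := hmin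
  obtain ⟨a, x₀, hx₀, hx⟩ := hX.exists_homogeneous_ne_zero (f := ρ ^ l * hb.proj) (by
    intro h
    have h1 := LinearMap.congr_fun h v
    rw [Module.End.mul_apply, hb.proj_of_orthogonal ((memQ v).1 hvQ)] at h1
    exact hv h1)
  rw [Module.End.mul_apply] at hx
  obtain ⟨j, y₀, hy₀, hy⟩ := hX.exists_homogeneous_ne_zero (hX.apply_ne_zero hx)
  rw [← hb.apply_eq_apply_proj ((memQ _).1 (pow_mem_of_invariant hQ (hproj x₀) l))] at hy
  have hxa := hb.proj_mem hX hx₀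
  have hyj := hb.proj_mem hX hy₀
  have hj : j = l - a := by
    by_contra h
    refine hy (hX.orthogonal _ _ ?_ _ (hd.pow_mem l hxa) _ hyj)
    intro h'
    exact h (by linarith)
  subst hj
  obtain ⟨c, hc, φ, hφQ, hφ⟩ :=
    exists_indecomposable hX hρ hd hQ hnil (hproj x₀) (hproj y₀) hxa hyj hy
  exact ⟨c, hc, hb.cons hX c φ (fun x => (memQ _).1 (hφQ x)) hφ.1 hφ.2.1 hφ.2.2⟩

theorem length_le_card_boxOf (C : List SymbolType) : C.length ≤ Fintype.card (BoxOf C) := by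
  calc C.length = ∑ _i : Fin C.length, 1 := by simp
    _ ≤ ∑ i : Fin C.length, Fintype.card (C.get i).Box :=
      Finset.sum_le_sum fun i _ => Fintype.card_pos
    _ = Fintype.card (BoxOf C) := Fintype.card_sigma.symm

theorem exists_isSkewTableau [FiniteDimensional ℝ V] (hX : IsGradedSymplectic 𝒳 σ)
    (hρ : ∀ x y, σ (ρ x) y = -σ x (ρ y)) (hd : HasDegree 𝒳 (-1) ρ) :
    ∃ C : List SymbolType, (∀ c ∈ C, c.Admissible) ∧
      ∃ b : Module.Basis (BoxOf C) ℝ V, IsSkewTableau 𝒳 σ ρ C b := by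
  -- Splitting off continues until the tableau spans. Each symbol has at least one box, so linear
  -- independence bounds the number of symbols by the dimension.
  have step : ∀ n : ℕ, ∃ C : List SymbolType, (∀ c ∈ C, c.Admissible) ∧ ∃ b : BoxOf C → V,
      IsPartialTableau 𝒳 σ ρ C b ∧ (Submodule.span ℝ (Set.range b) = ⊤ ∨ n ≤ C.length) := by
    intro n
    induction n with
    | zero =>
      exact ⟨[], by simp, fun k => k.1.elim0, ⟨fun i => i.elim0, fun i => i.elim0,
        fun i => i.elim0, fun i => i.elim0⟩, Or.inr (Nat.zero_le _)⟩
    | succ n ih =>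
      obtain ⟨C, hC, b, hb, h⟩ := ih
      by_cases hspan : Submodule.span ℝ (Set.range b) = ⊤
      · exact ⟨C, hC, b, hb, Or.inl hspan⟩
      · obtain ⟨c, hc, b', hb'⟩ := hb.exists_cons hX hρ hd hspan
        refine ⟨c :: C, ?_, b', hb', Or.inr ?_⟩
        · simpa using ⟨hc, hC⟩
        · simpa using h.resolve_left hspan
  obtain ⟨C, hC, b, hb, h⟩ := step (Module.finrank ℝ V + 1)
  have hcard := hb.linearIndependent.fintype_card_le_finrank
  have hlen := length_le_card_boxOf C
  have hspan := h.resolve_right (by omega)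
  refine ⟨C, hC, Module.Basis.mk hb.linearIndependent hspan.ge, ?_, ?_, ?_, ?_⟩
  all_goals simp only [Module.Basis.mk_apply]
  exacts [hb.weight, hb.form_same, hb.form_ne, hb.shift]

end Existence

/-! ### Existence of `𝔰𝔩₂`-triples -/

section Sl2

variable {V : Type*} [AddCommGroup V] [Module ℝ V]
  {𝒳 : ℚ → Submodule ℝ V} {σ : LinearMap.BilinForm ℝ V} {ρ : Module.End ℝ V}
  {C : List SymbolType} {b : Module.Basis (BoxOf C) ℝ V}

theorem commutator_apply (f g : Module.End ℝ V) (x : V) : ⁅f, g⁆ x = f (g x) - g (f x) := rfl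

theorem mem_spAlg {A : Module.End ℝ V} : A ∈ spAlg σ ↔ ∀ x y, σ (A x) y = -σ x (A y) := by
  rw [LinearMap.mem_skewAdjointSubmodule]
  simp [LinearMap.IsSkewAdjoint, LinearMap.IsAdjointPair]

theorem mem_spAlg_of_basis {ι : Type*} (b : Module.Basis ι ℝ V) {A : Module.End ℝ V}
    (h : ∀ i j, σ (A (b i)) (b j) + σ (b i) (A (b j)) = 0) : A ∈ spAlg σ := by
  have key : σ ∘ₗ A = -(σ.compl₂ A) := by
    refine LinearMap.ext_basis b b fun i j => ?_
    simpa using eq_neg_of_add_eq_zero_left (h i j)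
  rw [mem_spAlg]
  intro x y
  exact LinearMap.congr_fun (LinearMap.congr_fun key x) y

theorem IsSkewTableau.hasDegree_of_basis (hX : IsGradedSymplectic 𝒳 σ)
    (hb : IsSkewTableau 𝒳 σ ρ C b) {j : ℚ} {A : Module.End ℝ V}
    (h : ∀ k, A (b k) ∈ 𝒳 (boxWeight k + j)) : HasDegree 𝒳 j A := by
  intro i x hx
  rw [← b.sum_repr x, map_sum]
  refine (𝒳 _).sum_mem fun k _ => ?_
  rw [map_smul]
  by_cases hk : boxWeight k = i
  · exact (𝒳 _).smul_mem _ (hk ▸ h k)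
  · have h1 := hb.isPartialTableau.apply_sum_dualBox (b.repr x) k
    rw [b.sum_repr, hX.orthogonal i (boxWeight (dualBox k))
      (by rw [boxWeight_dualBox]; intro h'; exact hk (by linarith)) x hx _ (hb.weight _ _)] at h1
    rw [(mul_eq_zero.mp h1.symm).resolve_right (hb.isPartialTableau.apply_dualBox_self k), zero_smul]
    exact Submodule.zero_mem _

theorem IsSkewTableau.exists_isNiceSl2 (hX : IsGradedSymplectic 𝒳 σ)
    (hρ : ∀ x y, σ (ρ x) y = -σ x (ρ y)) (hd : HasDegree 𝒳 (-1) ρ)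
    (hb : IsSkewTableau 𝒳 σ ρ C b) : ∃ h e : Module.End ℝ V, IsNiceSl2 𝒳 σ h e ρ := by
  -- The coefficients of the irreducible `𝔰𝔩₂`-module of dimension `len`, with `ρ` acting by plain
  -- shifts. They are compatible with `σ` because `hc` is odd under `pos ↦ len - 1 - pos` and `ec`
  -- is even under `pos ↦ len - pos`.
  let hc : BoxOf C → ℝ := fun k => (C.get k.1).len - 1 - 2 * (C.get k.1).pos k.2
  let ec : BoxOf C → ℝ := fun k =>
    (C.get k.1).pos k.2 * ((C.get k.1).len - (C.get k.1).pos k.2)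
  let h : Module.End ℝ V := b.constr ℝ fun k => hc k • b k
  let e : Module.End ℝ V := b.constr ℝ fun k =>
    ec k • ((C.get k.1).prev k.2).elim 0 fun y => b ⟨k.1, y⟩
  have hh : ∀ k, h (b k) = hc k • b k := fun k => b.constr_basis ..
  have he : ∀ k, e (b k) = ec k • ((C.get k.1).prev k.2).elim 0 fun y => b ⟨k.1, y⟩ :=
    fun k => b.constr_basis ..
  have h_mem : h ∈ spAlg σ := by
    refine mem_spAlg_of_basis b ?_
    rintro ⟨i, x⟩ ⟨j, y⟩
    simp only [hh, map_smul, LinearMap.smul_apply, smul_eq_mul, ← add_mul]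
    by_cases hij : i = j
    · subst hij
      by_cases h0 : (C.get i).form x y = 0
      · rw [hb.form_same, h0, mul_zero]
      · have h1 : (((C.get i).pos x + (C.get i).pos y + 1 : ℕ) : ℝ) = (C.get i).len := by
          rw [SymbolType.form_ne_zero _ h0]
        push_cast at h1
        rw [show hc ⟨i, x⟩ + hc ⟨i, y⟩ = 0 by simp only [hc]; linarith, zero_mul]
    · rw [hb.form_ne _ _ _ _ hij, mul_zero]
  have e_mem : e ∈ spAlg σ := by
    refine mem_spAlg_of_basis b ?_
    rintro ⟨i, x⟩ ⟨j, y⟩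
    by_cases hij : i = j
    · subst hij
      simp only [he]
      rcases hx : (C.get i).prev x with _ | x' <;> rcases hy : (C.get i).prev y with _ | y'
      · simp
      · have := SymbolType.prev_none _ hx
        have hy1 := (SymbolType.next_some _ ((SymbolType.next_eq_some_iff_prev _).2 hy)).1
        simp only [Option.elim, smul_zero, map_zero, LinearMap.zero_apply, zero_add, map_smul,
          smul_eq_mul, hb.form_same]
        -- A nonzero pairing would put `y` at position `len`, where `ec` vanishes in any case.
        by_cases h0 : (C.get i).form x y' = 0
        · rw [h0, mul_zero]
        · have h1 := SymbolType.form_ne_zero _ h0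
          have h2 : (C.get i).pos y = (C.get i).len := by omega
          simp only [ec, h2, sub_self, mul_zero, zero_mul]
      · have := SymbolType.prev_none _ hy
        have hx1 := (SymbolType.next_some _ ((SymbolType.next_eq_some_iff_prev _).2 hx)).1
        simp only [Option.elim, smul_zero, map_zero, add_zero, map_smul, LinearMap.smul_apply,
          smul_eq_mul, hb.form_same]
        by_cases h0 : (C.get i).form x' y = 0
        · rw [h0, mul_zero]
        · have h1 := SymbolType.form_ne_zero _ h0
          have h2 : (C.get i).pos x = (C.get i).len := by omega
          simp only [ec, h2, sub_self, mul_zero, zero_mul]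
      · rw [← SymbolType.next_eq_some_iff_prev] at hx hy
        have hx1 := (SymbolType.next_some _ hx).1
        have h3 := hρ (b ⟨i, x'⟩) (b ⟨i, y'⟩)
        rw [hb.shift, hb.shift, hx, hy] at h3
        simp only [Option.elim, hb.form_same] at h3
        simp only [Option.elim, map_smul, LinearMap.smul_apply, smul_eq_mul, hb.form_same]
        rw [← neg_eq_iff_eq_neg.2 h3]
        by_cases h0 : (C.get i).form x y' = 0
        · rw [h0]; ring
        · have h1 := SymbolType.form_ne_zero _ h0
          have hy1 := (SymbolType.next_some _ hy).1
          have h2 : (((C.get i).pos x + (C.get i).pos y : ℕ) : ℝ) = (C.get i).len := by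
            congr 1; omega
          push_cast at h2
          simp only [ec, ← h2]
          ring
    · have hz : ∀ z : Option (C.get i).Box, σ (z.elim 0 fun y => b ⟨i, y⟩) (b ⟨j, y⟩) = 0 := by
        rintro (_ | z)
        · simp
        · exact hb.form_ne _ _ _ _ hij
      have hz' : ∀ z : Option (C.get j).Box, σ (b ⟨i, x⟩) (z.elim 0 fun y => b ⟨j, y⟩) = 0 := by
        rintro (_ | z)
        · simp
        · exact hb.form_ne _ _ _ _ hij
      simp only [he, map_smul, LinearMap.smul_apply, hz, hz', smul_zero, add_zero]
  have hdeg : HasDegree 𝒳 0 h := hb.hasDegree_of_basis hX fun k => by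
    rw [hh, add_zero]
    exact Submodule.smul_mem _ _ (hb.weight _ _)
  have edeg : HasDegree 𝒳 1 e := hb.hasDegree_of_basis hX fun k => by
    rw [he]
    refine Submodule.smul_mem _ _ ?_
    rcases hx : (C.get k.1).prev k.2 with _ | x'
    · exact Submodule.zero_mem _
    · have := (SymbolType.next_some _ ((SymbolType.next_eq_some_iff_prev _).2 hx)).2.1
      rw [boxWeight, this, sub_add_cancel]
      exact hb.weight _ _
  refine ⟨h, e, ⟨h_mem, hdeg⟩, ⟨e_mem, edeg⟩, ⟨mem_spAlg.2 hρ, hd⟩, ?_, ?_, ?_⟩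
  · refine b.ext ?_
    rintro ⟨i, x⟩
    rw [commutator_apply, hh, he, hb.shift]
    rcases hx : (C.get i).next x with _ | y <;> rcases hz : (C.get i).prev x with _ | z
    · have h1 := SymbolType.next_none _ hx
      have h2 := SymbolType.prev_none _ hz
      simp only [Option.elim, map_zero, smul_zero, sub_zero, hc, ← h1, h2]
      norm_num
    · have h1 := SymbolType.next_none _ hx
      have h2 := (SymbolType.next_eq_some_iff_prev _).2 hz
      simp only [Option.elim, map_zero, zero_sub, map_smul, hb.shift, h2, ec, hc, ← h1]
      rw [← neg_smul]
      congr 1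
      push_cast
      ring
    · have h1 := SymbolType.prev_none _ hz
      have h2 := (SymbolType.next_eq_some_iff_prev _).1 hx
      have h3 := (SymbolType.next_some _ hx).1
      simp only [Option.elim, smul_zero, map_zero, sub_zero, he, h2, ec, hc, h3, h1]
      congr 1
      push_cast
      ring
    · have h1 := (SymbolType.next_eq_some_iff_prev _).2 hz
      have h2 := (SymbolType.next_eq_some_iff_prev _).1 hx
      have h3 := (SymbolType.next_some _ hx).1
      simp only [Option.elim, map_smul, hb.shift, h1, he, h2, ec, hc, h3]
      rw [← sub_smul]
      congr 1
      push_cast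
      ring
  · refine b.ext ?_
    rintro ⟨i, x⟩
    rw [commutator_apply, hh, LinearMap.smul_apply, map_smul, he]
    rcases hz : (C.get i).prev x with _ | z
    · simp
    · have h3 := (SymbolType.next_some _ ((SymbolType.next_eq_some_iff_prev _).2 hz)).1
      simp only [Option.elim, map_smul, hh, smul_smul]
      rw [← sub_smul]
      congr 1
      simp only [hc, h3]
      push_cast
      ring
  · refine b.ext ?_
    rintro ⟨i, x⟩
    rw [commutator_apply, hh, LinearMap.neg_apply, LinearMap.smul_apply, map_smul, hb.shift]
    rcases hz : (C.get i).next x with _ | z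
    · simp
    · have h3 := (SymbolType.next_some _ hz).1
      simp only [Option.elim, hh]
      rw [← sub_smul, ← neg_smul]
      congr 1
      simp only [hc, h3]
      push_cast
      ring

end Sl2

/-! ### Rank one elements of `𝔩(X)` -/

theorem not_rowsOverlap_iff {C : List SymbolType} (hC : ∀ c ∈ C, c.Admissible) :
    ¬ RowsOverlap (C.flatMap SymbolType.rows) ↔
      ∃ s l, SymbolType.delta s l ∈ C ∧ (l : ℚ) ≤ s := by
  constructor
  · intro h
    simp only [RowsOverlap, not_forall, not_not] at h
    obtain ⟨i, j, -, hij⟩ := h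
    obtain ⟨c, hc, hi⟩ := List.mem_flatMap.1 (List.get_mem _ i)
    obtain ⟨c', hc', hj⟩ := List.mem_flatMap.1 (List.get_mem _ j)
    generalize List.get _ i = r at *
    generalize List.get _ j = r' at *
    have hl : r.left < 0 → ∃ s l, SymbolType.delta s l ∈ C ∧ (l : ℚ) ≤ s := by
      intro h
      rcases c with ⟨s, l⟩ | ⟨n, ε⟩
      · simp only [SymbolType.rows, List.mem_cons, List.not_mem_nil, or_false] at hi
        have hl : (0 : ℚ) ≤ l := l.cast_nonneg
        rcases hi with rfl | rfl
        · rcases hC _ hc with ⟨k, -, h1⟩ | ⟨k, -, h1⟩ <;> simp only at h <;> linarith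
        · exact ⟨s, l, hc, by simp only at h; linarith⟩
      · simp only [SymbolType.rows, List.mem_singleton] at hi
        subst hi
        have : (0 : ℚ) ≤ n := n.cast_nonneg
        simp only at h
        linarith
    have hr : 0 ≤ r'.right → ∃ s l, SymbolType.delta s l ∈ C ∧ (l : ℚ) ≤ s := by
      intro h
      rcases c' with ⟨s, l⟩ | ⟨n, ε⟩
      · simp only [SymbolType.rows, List.mem_cons, List.not_mem_nil, or_false] at hj
        have hl : (0 : ℚ) ≤ l := l.cast_nonneg
        refine ⟨s, l, hc', ?_⟩
        rcases hj with rfl | rfl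
        · simp only [SkewRow.right] at h
          push_cast at h
          linarith
        · simp only [SkewRow.right] at h
          push_cast at h
          rcases hC _ hc' with ⟨k, -, h1⟩ | ⟨k, -, h1⟩ <;> linarith
      · simp only [SymbolType.rows, List.mem_singleton] at hj
        subst hj
        have : (0 : ℚ) ≤ n := n.cast_nonneg
        simp only [SkewRow.right] at h
        push_cast at h
        linarith
    -- Column `0` separates the two cases: from `r.left ≤ r'.right`, either `r` starts at negative
    -- weight or `r'` ends at weight `≥ 0`. Rows of `τ_m` do neither.
    rcases lt_or_ge r.left 0 with h | h
    · exact hl h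
    · exact hr (h.trans hij)
  · rintro ⟨s, l, hc, hl⟩ h
    obtain ⟨C₁, C₂, rfl⟩ := List.append_of_mem hc
    set D := (C₁ ++ SymbolType.delta s l :: C₂).flatMap SymbolType.rows with hD
    have hD' : D = C₁.flatMap SymbolType.rows ++ ⟨s, l + 1⟩ :: ⟨l - s, l + 1⟩ ::
        C₂.flatMap SymbolType.rows := by
      rw [hD, List.flatMap_append, List.flatMap_cons]
      rfl
    clear_value D
    subst hD'
    -- The two rows of `δ_{s,l}` itself: the lower one starts at `l - s`, the upper one ends at `s -
    -- l`.
    refine h ⟨(C₁.flatMap SymbolType.rows).length + 1, by simp⟩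
      ⟨(C₁.flatMap SymbolType.rows).length, by simp⟩ (by simp) ?_
    simp [SkewRow.right]
    linarith

section RankOne

variable {V : Type*} [AddCommGroup V] [Module ℝ V]
  {𝒳 : ℚ → Submodule ℝ V} {σ : LinearMap.BilinForm ℝ V} {h e ρ : Module.End ℝ V}

/-- The commutator with a fixed endomorphism. -/
noncomputable def commutatorMap (g : Module.End ℝ V) : Module.End ℝ (Module.End ℝ V) :=
  LinearMap.mulLeft ℝ g - LinearMap.mulRight ℝ g

theorem lie_mem_lAlg {A : Module.End ℝ V} (hA : A ∈ lAlg 𝒳 σ h e ρ) :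
    ⁅ρ, A⁆ ∈ lAlg 𝒳 σ h e ρ := by
  suffices lAlg 𝒳 σ h e ρ ≤ (lAlg 𝒳 σ h e ρ).comap (commutatorMap ρ) from this hA
  refine sSup_le fun W hW A hA => ?_
  exact (le_sSup hW : W ≤ lAlg 𝒳 σ h e ρ) (hW.2 A hA).2.2

theorem lAlg_le_spNonneg : lAlg 𝒳 σ h e ρ ≤ spNonneg 𝒳 σ := sSup_le fun _ hW => hW.1

theorem spNonneg_le_spAlg : spNonneg 𝒳 σ ≤ spAlg σ := iSup₂_le fun _ _ _ hA => hA.1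

/-- A component of degree `j ≥ 0` pairs weights `i + j` and `i`, whose sum is positive. -/
theorem apply_eq_zero_of_mem_spNonneg (hX : IsGradedSymplectic 𝒳 σ) {A : Module.End ℝ V}
    (hA : A ∈ spNonneg 𝒳 σ) {i : ℚ} (hi : 0 < i) {x : V} (hx : x ∈ 𝒳 i) : σ (A x) x = 0 := by
  suffices spNonneg 𝒳 σ ≤ LinearMap.ker ((σ.flip x) ∘ₗ LinearMap.applyₗ (R := ℝ) x) from this hA
  refine iSup₂_le fun j hj B hB => ?_
  exact hX.orthogonal _ _ (by intro h; linarith) _ (hB.2 i x hx) x hx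

theorem exists_eq_smul_of_finrank_range_eq_one (hX : IsGradedSymplectic 𝒳 σ) {A : Module.End ℝ V}
    (hA : A ∈ spAlg σ) (h1 : Module.finrank ℝ (LinearMap.range A) = 1) :
    ∃ v : V, v ≠ 0 ∧ ∃ c : ℝ, c ≠ 0 ∧ ∀ x, A x = (c * σ v x) • v := by
  rw [mem_spAlg] at hA
  obtain ⟨⟨v, z, hz⟩, hv, hspan⟩ := finrank_eq_one_iff'.1 h1
  have hv : v ≠ 0 := fun h => hv (Subtype.ext h)
  have hφ : ∀ x, ∃ t : ℝ, t • v = A x := by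
    intro x
    obtain ⟨t, ht⟩ := hspan ⟨A x, x, rfl⟩
    exact ⟨t, congrArg Subtype.val ht⟩
  choose φ hφ using hφ
  obtain ⟨y, hy⟩ : ∃ y, σ v y ≠ 0 := by
    by_contra! h
    exact hv (hX.nondegenerate.1 v h)
  -- With `A x = φ x • v`, skewness gives `φ x * σ v y = φ y * σ v x`, so `φ` is proportional to `σ
  -- v`.
  have key : ∀ x, A x = (φ y / σ v y * σ v x) • v := by
    intro x
    have h2 := hA x y
    rw [← hφ x, ← hφ y, map_smul, map_smul, LinearMap.smul_apply, smul_eq_mul, smul_eq_mul,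
      ← hX.alt.neg_eq v x] at h2
    rw [← hφ x]
    congr 1
    field_simp
    linarith
  refine ⟨v, hv, φ y / σ v y, ?_, key⟩
  intro h0
  rw [key z, h0, zero_mul, zero_smul] at hz
  exact hv hz.symm

/-- Left and right multiplication by `ρ` commute, so the binomial theorem applies. -/
theorem commutatorMap_pow_apply (n : ℕ) (A : Module.End ℝ V) :
    (commutatorMap ρ ^ n) A =
      ∑ m ∈ Finset.range (n + 1), ((-1) ^ (n - m) * (n.choose m : ℝ)) • (ρ ^ m * A * ρ ^ (n - m)) := by
  have hcomm : Commute (LinearMap.mulLeft ℝ ρ) (-LinearMap.mulRight ℝ ρ) :=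
    (LinearMap.commute_mulLeft_right (R := ℝ) ρ ρ).neg_right
  have had : commutatorMap ρ =
      LinearMap.mulLeft ℝ ρ + -LinearMap.mulRight ℝ ρ := by
    rw [commutatorMap, sub_eq_add_neg]
  rw [had, hcomm.add_pow, LinearMap.sum_apply]
  refine Finset.sum_congr rfl fun m _ => ?_
  have hneg : -LinearMap.mulRight ℝ ρ = (-1 : ℝ) • LinearMap.mulRight ℝ ρ :=
    (neg_one_smul ℝ (LinearMap.mulRight ℝ ρ)).symm
  rw [hneg, smul_pow, LinearMap.pow_mulLeft, LinearMap.pow_mulRight, Module.End.mul_apply,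
    Module.End.natCast_apply, ← Nat.cast_smul_eq_nsmul ℝ]
  simp only [Module.End.mul_apply, LinearMap.smul_apply, LinearMap.mulLeft_apply,
    LinearMap.mulRight_apply, smul_mul_assoc, mul_smul_comm, smul_smul, mul_assoc]

theorem exists_mem_ker_of_rank_one [FiniteDimensional ℝ V] (hX : IsGradedSymplectic 𝒳 σ)
    (hρ : ∀ x y, σ (ρ x) y = -σ x (ρ y)) (hd : HasDegree 𝒳 (-1) ρ) {A : Module.End ℝ V}
    (hA : A ∈ lAlg 𝒳 σ h e ρ) (h1 : Module.finrank ℝ (LinearMap.range A) = 1) :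
    ∃ u : V, u ≠ 0 ∧ ρ u = 0 ∧ ∀ i, 0 < i → ∀ x ∈ 𝒳 i, σ u x = 0 := by
  classical
  obtain ⟨v, hv, c, hc, hAv⟩ := exists_eq_smul_of_finrank_range_eq_one hX
    (spNonneg_le_spAlg (lAlg_le_spNonneg hA)) h1
  have hex : ∃ n : ℕ, (ρ ^ n) v = 0 := by
    obtain ⟨n, hn⟩ := hd.isNilpotent hX
    exact ⟨n, by rw [hn, LinearMap.zero_apply]⟩
  obtain ⟨p, hp⟩ : ∃ p, Nat.find hex = p + 1 := by
    refine Nat.exists_eq_succ_of_ne_zero fun h0 => hv ?_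
    have := Nat.find_spec hex
    rw [h0] at this
    simpa using this
  have hnil := Nat.find_spec hex
  rw [hp] at hnil
  refine ⟨(ρ ^ p) v, Nat.find_min hex (by omega), ?_, fun i hi x hx => ?_⟩
  · rw [← Module.End.mul_apply, ← pow_succ', hnil]
  have hmem : ∀ n : ℕ, (commutatorMap ρ ^ n) A ∈ lAlg 𝒳 σ h e ρ := by
    intro n
    induction n with
    | zero => simpa using hA
    | succ n ih =>
      rw [pow_succ', Module.End.mul_apply]
      exact lie_mem_lAlg ih
  have h2 := apply_eq_zero_of_mem_spNonneg hX (lAlg_le_spNonneg (hmem (2 * p))) hi hx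
  have hterm : ∀ m n : ℕ, σ ((ρ ^ m * A * ρ ^ n) x) x =
      c * (-1) ^ n * σ ((ρ ^ n) v) x * σ ((ρ ^ m) v) x := by
    intro m n
    have h3 : (-1 : ℝ) ^ n * (-1) ^ n = 1 := by rw [← mul_pow]; simp
    rw [Module.End.mul_apply, Module.End.mul_apply, hAv, map_smul, map_smul, LinearMap.smul_apply,
      smul_eq_mul, skew_pow hρ n v]
    linear_combination (-c * σ v ((ρ ^ n) x) * σ ((ρ ^ m) v) x) * h3
  -- For `m ≠ p`, one of `m` and `2p - m` exceeds `p`, so only the middle term survives. It is a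
  -- nonzero multiple of `(σ (ρ^p v) x)²`.
  rw [commutatorMap_pow_apply, LinearMap.sum_apply, map_sum, LinearMap.sum_apply,
    Finset.sum_eq_single p] at h2
  · rw [LinearMap.smul_apply, map_smul, LinearMap.smul_apply, hterm,
      show 2 * p - p = p by omega, smul_eq_mul] at h2
    have h4 : (((2 * p).choose p : ℕ) : ℝ) ≠ 0 :=
      Nat.cast_ne_zero.2 (Nat.choose_pos (by omega)).ne'
    simpa [hc, h4] using h2
  · intro m hm hmp
    rw [Finset.mem_range] at hm
    rw [LinearMap.smul_apply, map_smul, LinearMap.smul_apply, hterm]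
    rcases lt_or_gt_of_ne hmp with h | h
    · rw [pow_eq_zero_of_lt hnil (by omega : p < 2 * p - m)]
      simp
    · rw [pow_eq_zero_of_lt hnil h]
      simp
  · intro h
    exact (h (by rw [Finset.mem_range]; omega)).elim

theorem IsSkewTableau.exists_delta_of_mem_ker (hX : IsGradedSymplectic 𝒳 σ)
    (hρ : ∀ x y, σ (ρ x) y = -σ x (ρ y)) {C : List SymbolType} (hC : ∀ c ∈ C, c.Admissible)
    {b : Module.Basis (BoxOf C) ℝ V} (hb : IsSkewTableau 𝒳 σ ρ C b) {u : V} (hu : u ≠ 0)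
    (hu0 : ρ u = 0) (hup : ∀ i, 0 < i → ∀ x ∈ 𝒳 i, σ u x = 0) :
    ∃ s l, SymbolType.delta s l ∈ C ∧ (l : ℚ) ≤ s := by
  obtain ⟨⟨i, x⟩, hx⟩ : ∃ k, σ u (b k) ≠ 0 := by
    by_contra! h
    refine hX.apply_ne_zero hu (b.ext fun k => ?_)
    rw [h, LinearMap.zero_apply]
  have hw : (C.get i).weight x ≤ 0 := by
    by_contra! h
    exact hx (hup _ h _ (hb.weight i x))
  -- The image of `ρ` is skew-orthogonal to `ker ρ`, so a box pairing with `u` must be leftmost in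
  -- its row. Its weight being `≤ 0` then singles out `δ_{s,l}` with `l ≤ s`.
  have hn : (C.get i).prev x = none := by
    rcases hy : (C.get i).prev x with _ | y
    · rfl
    · rw [← SymbolType.next_eq_some_iff_prev] at hy
      have h1 := hρ u (b ⟨i, y⟩)
      rw [hu0, hb.shift, hy, map_zero, LinearMap.zero_apply] at h1
      exact (hx (neg_eq_zero.1 h1.symm)).elim
  have hpos := SymbolType.prev_none _ hn
  have hmem : C.get i ∈ C := List.get_mem _ _
  clear hx hn
  generalize C.get i = c at x hw hpos hmem
  rcases c with ⟨s, l⟩ | ⟨n, ε⟩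
  · have hl : (0 : ℚ) ≤ l := l.cast_nonneg
    refine ⟨s, l, hmem, ?_⟩
    rcases x with k | k <;> simp only [SymbolType.weight, SymbolType.pos] at hw hpos
    · rw [hpos] at hw
      push_cast at hw
      rcases hC _ hmem with ⟨k, -, h1⟩ | ⟨k, -, h1⟩ <;> linarith
    · rw [hpos] at hw
      push_cast at hw
      linarith
  · simp only [SymbolType.weight, SymbolType.pos] at hw hpos
    rw [hpos] at hw
    have : (0 : ℚ) ≤ n := n.cast_nonneg
    push_cast at hw
    linarith

/-- The element `u • v` of `S²(X) ≅ 𝔰𝔭(X)`. -/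
noncomputable def symProd (σ : LinearMap.BilinForm ℝ V) : V →ₗ[ℝ] V →ₗ[ℝ] Module.End ℝ V :=
  LinearMap.mk₂ ℝ (fun u v => (σ u).smulRight v + (σ v).smulRight u)
    (fun u u' v => by ext x; simp [add_smul]; abel)
    (fun c u v => by ext x; simp [smul_smul, mul_comm])
    (fun u v v' => by ext x; simp [add_smul]; abel)
    (fun c u v => by ext x; simp [smul_smul, mul_comm])

theorem symProd_apply (u v x : V) : symProd σ u v x = σ u x • v + σ v x • u := rfl

theorem symProd_mem_spDeg (hX : IsGradedSymplectic 𝒳 σ) {i j : ℚ} {u v : V} (hu : u ∈ 𝒳 i)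
    (hv : v ∈ 𝒳 j) : symProd σ u v ∈ spDeg 𝒳 σ (i + j) := by
  refine ⟨mem_spAlg.2 fun x y => ?_, fun k x hx => ?_⟩
  · simp only [symProd_apply, map_add, map_smul, LinearMap.add_apply, LinearMap.smul_apply,
      smul_eq_mul]
    rw [← hX.alt.neg_eq u x, ← hX.alt.neg_eq v x]
    ring
  · have key : ∀ {i j : ℚ} {u v : V}, u ∈ 𝒳 i → v ∈ 𝒳 j → σ u x • v ∈ 𝒳 (k + (i + j)) := by
      intro i j u v hu hv
      by_cases h : i + k = 0
      · rw [show k + (i + j) = j by linarith]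
        exact (𝒳 _).smul_mem _ hv
      · rw [hX.orthogonal i k h u hu x hx, zero_smul]
        exact Submodule.zero_mem _
    rw [symProd_apply]
    refine (𝒳 _).add_mem (key hu hv) ?_
    rw [add_comm i j]
    exact key hv hu

theorem map₂_symProd_le_spNonneg (hX : IsGradedSymplectic 𝒳 σ) :
    Submodule.map₂ (symProd σ) (⨆ (i : ℚ) (_ : 0 ≤ i), 𝒳 i) (⨆ (i : ℚ) (_ : 0 ≤ i), 𝒳 i) ≤
      spNonneg 𝒳 σ := by
  simp only [Submodule.map₂_iSup_left, Submodule.map₂_iSup_right]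
  refine iSup₂_le fun j hj => iSup₂_le fun i hi => ?_
  rw [Submodule.map₂_le]
  intro u hu v hv
  exact (le_iSup₂_of_le (i + j) (add_nonneg hi hj) le_rfl : spDeg 𝒳 σ (i + j) ≤ spNonneg 𝒳 σ)
    (symProd_mem_spDeg hX hu hv)

theorem lie_symProd {g : Module.End ℝ V} (hg : g ∈ spAlg σ) (u v : V) :
    ⁅g, symProd σ u v⁆ = symProd σ (g u) v + symProd σ u (g v) := by
  rw [mem_spAlg] at hg
  ext x
  simp only [commutator_apply, symProd_apply, LinearMap.add_apply, map_add, map_smul, hg,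
    neg_smul]
  abel

theorem map₂_symProd_le_lAlg (hX : IsGradedSymplectic 𝒳 σ) (hsl : IsNiceSl2 𝒳 σ h e ρ)
    {Y : Submodule ℝ V} (hY : Y ≤ ⨆ (i : ℚ) (_ : 0 ≤ i), 𝒳 i) (hh : Y ≤ Y.comap h)
    (he : Y ≤ Y.comap e) (hf : Y ≤ Y.comap ρ) :
    Submodule.map₂ (symProd σ) Y Y ≤ lAlg 𝒳 σ h e ρ := by
  have key : ∀ g ∈ spAlg σ, Y ≤ Y.comap g → ∀ A ∈ Submodule.map₂ (symProd σ) Y Y,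
      ⁅g, A⁆ ∈ Submodule.map₂ (symProd σ) Y Y := by
    intro g hg hgY
    suffices Submodule.map₂ (symProd σ) Y Y ≤ (Submodule.map₂ (symProd σ) Y Y).comap
      (commutatorMap g) from fun A hA => this hA
    rw [Submodule.map₂_le]
    intro u hu v hv
    change ⁅g, symProd σ u v⁆ ∈ Submodule.map₂ (symProd σ) Y Y
    rw [lie_symProd hg]
    exact Submodule.add_mem _ (Submodule.apply_mem_map₂ _ (hgY hu) hv)
      (Submodule.apply_mem_map₂ _ hu (hgY hv))
  refine le_sSup ⟨(Submodule.map₂_le_map₂ hY hY).trans (map₂_symProd_le_spNonneg hX), fun A hA => ?_⟩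
  exact ⟨key h hsl.h_mem.1 hh A hA, key e hsl.e_mem.1 he A hA, key ρ hsl.f_mem.1 hf A hA⟩

theorem exists_sl2_submodule (hsl : IsNiceSl2 𝒳 σ h e ρ) {i : ℚ} (hi : 0 ≤ i) {u : V}
    (hu : u ∈ 𝒳 i) (hu0 : ρ u = 0) :
    ∃ Y : Submodule ℝ V, u ∈ Y ∧ Y ≤ (⨆ (i : ℚ) (_ : 0 ≤ i), 𝒳 i) ∧ Y ≤ Y.comap h ∧
      Y ≤ Y.comap e ∧ Y ≤ Y.comap ρ := by
  set P : Submodule ℝ V := ⨆ (i : ℚ) (_ : 0 ≤ i), 𝒳 i with hP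
  have hdeg : ∀ {j : ℚ} {g : Module.End ℝ V}, 0 ≤ j → HasDegree 𝒳 j g → P ≤ P.comap g := by
    intro j g hj hg
    refine iSup₂_le fun i hi x hx => ?_
    exact (le_iSup₂_of_le (i + j) (add_nonneg hi hj) le_rfl : 𝒳 (i + j) ≤ P) (hg i x hx)
  have hPh := hdeg le_rfl hsl.h_mem.2
  have hPe := hdeg zero_le_one hsl.e_mem.2
  have hhρ : ∀ x, ρ (h x) = h (ρ x) + (2 : ℝ) • ρ x := by
    intro x
    have := LinearMap.congr_fun hsl.lie_h_f x
    rw [commutator_apply, LinearMap.neg_apply, LinearMap.smul_apply] at this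
    rw [← neg_eq_iff_eq_neg.2 this]
    abel
  have hhe : ∀ x, h (e x) = e (h x) + (2 : ℝ) • e x := by
    intro x
    have := LinearMap.congr_fun hsl.lie_h_e x
    rw [commutator_apply, LinearMap.smul_apply] at this
    rw [← this]
    abel
  have hρe : ∀ x, ρ (e x) = e (ρ x) - h x := by
    intro x
    have := LinearMap.congr_fun hsl.lie_e_f x
    rw [commutator_apply] at this
    rw [← this]
    abel
  -- All lowest vectors in non-negative weights are taken at once: `u` need not be an eigenvector of
  -- `h`, but `K` is `h`-stable.
  let K : Submodule ℝ V := LinearMap.ker ρ ⊓ P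
  have hKh : ∀ x ∈ K, h x ∈ K := by
    rintro x ⟨hx, hxP⟩
    rw [SetLike.mem_coe, LinearMap.mem_ker] at hx
    exact ⟨by rw [SetLike.mem_coe, LinearMap.mem_ker, hhρ, hx]; simp, hPh hxP⟩
  let Y : Submodule ℝ V := ⨆ n : ℕ, K.map (e ^ n)
  have mem : ∀ n : ℕ, ∀ x ∈ K, (e ^ n) x ∈ Y := fun n x hx =>
    (le_iSup (fun n : ℕ => K.map (e ^ n)) n) (Submodule.mem_map_of_mem hx)
  have pow_succ_apply : ∀ (n : ℕ) (x : V), (e ^ (n + 1)) x = e ((e ^ n) x) := fun n x => by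
    rw [pow_succ', Module.End.mul_apply]
  have le_of : ∀ S : Submodule ℝ V, (∀ n : ℕ, ∀ x ∈ K, (e ^ n) x ∈ S) → Y ≤ S := fun S hS =>
    iSup_le fun n => Submodule.map_le_iff_le_comap.2 fun x hx => hS n x hx
  have hYe : Y ≤ Y.comap e := le_of _ fun n x hx => by
    rw [Submodule.mem_comap, ← pow_succ_apply]
    exact mem _ x hx
  have hYh : Y ≤ Y.comap h := le_of _ fun n => by
    induction n with
    | zero => exact fun x hx => mem 0 _ (hKh x hx)
    | succ n ih =>
      intro x hx
      rw [Submodule.mem_comap, pow_succ_apply, hhe]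
      exact Y.add_mem (hYe (ih x hx)) (Y.smul_mem _ (hYe (mem n x hx)))
  refine ⟨Y, ?_, le_of _ fun n => ?_, hYh, hYe, le_of _ fun n => ?_⟩
  · exact mem 0 u ⟨hu0, (le_iSup₂_of_le i hi le_rfl : 𝒳 i ≤ P) hu⟩
  · induction n with
    | zero => exact fun x hx => hx.2
    | succ n ih =>
      intro x hx
      rw [pow_succ_apply]
      exact hPe (ih x hx)
  · induction n with
    | zero =>
      rintro x ⟨hx, -⟩
      rw [SetLike.mem_coe, LinearMap.mem_ker] at hx
      simp [hx]
    | succ n ih =>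
      intro x hx
      -- Since `ρ e = e ρ - h`, lowering `e^(n+1) x` reduces to lowering `e^n x` and applying `h` to
      -- it.
      rw [Submodule.mem_comap, pow_succ_apply, hρe]
      exact Y.sub_mem (hYe (ih x hx)) (hYh (mem n x hx))

theorem finrank_range_symProd_self (hX : IsGradedSymplectic 𝒳 σ) {u : V} (hu : u ≠ 0) :
    Module.finrank ℝ (LinearMap.range (symProd σ u u)) = 1 := by
  obtain ⟨y, hy⟩ : ∃ y, σ u y ≠ 0 := by
    by_contra! h
    exact hu (hX.nondegenerate.1 u h)
  have : LinearMap.range (symProd σ u u) = Submodule.span ℝ {u} := by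
    ext x
    rw [Submodule.mem_span_singleton]
    constructor
    · rintro ⟨z, rfl⟩
      exact ⟨σ u z + σ u z, by rw [symProd_apply, add_smul]⟩
    · rintro ⟨c, rfl⟩
      refine ⟨(c / (2 * σ u y)) • y, ?_⟩
      rw [symProd_apply, ← add_smul, map_smul, smul_eq_mul]
      congr 1
      field_simp
      ring
  rw [this, finrank_span_singleton hu]

theorem IsSkewTableau.exists_mem_ker_of_delta {C : List SymbolType}
    {b : Module.Basis (BoxOf C) ℝ V} (hb : IsSkewTableau 𝒳 σ ρ C b) {s : ℚ} {l : ℕ}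
    (hc : SymbolType.delta s l ∈ C) (hl : (l : ℚ) ≤ s) :
    ∃ i, 0 ≤ i ∧ ∃ u ∈ 𝒳 i, u ≠ 0 ∧ ρ u = 0 := by
  obtain ⟨i, hi⟩ := List.get_of_mem hc
  obtain ⟨x, hx, hn⟩ : ∃ x : (C.get i).Box, 0 ≤ (C.get i).weight x ∧ (C.get i).next x = none := by
    rw [hi]
    refine ⟨.inl (Fin.last l), ?_, ?_⟩
    · simpa [SymbolType.weight] using hl
    · simp [SymbolType.next]
  refine ⟨_, hx, b ⟨i, x⟩, hb.weight i x, b.ne_zero _, ?_⟩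
  rw [hb.shift, hn]
  rfl

end RankOne

theorem mainTheorem12 {V : Type*} [AddCommGroup V] [Module ℝ V] [FiniteDimensional ℝ V]
    (𝒳 : ℚ → Submodule ℝ V) (σ : LinearMap.BilinForm ℝ V) (hX : IsGradedSymplectic 𝒳 σ)
    (ρ : Module.End ℝ V) (hρ : IsSymplecticFlagSymbol 𝒳 σ ρ) :
    (∃ D : List SkewRow, IsSkewDiagramOf 𝒳 σ ρ D) ∧
    (∃ h e : Module.End ℝ V, IsNiceSl2 𝒳 σ h e ρ) ∧
    ∀ D : List SkewRow, IsSkewDiagramOf 𝒳 σ ρ D →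
      ∀ h e : Module.End ℝ V, IsNiceSl2 𝒳 σ h e ρ →
        ((∃ A ∈ lAlg 𝒳 σ h e ρ, Module.finrank ℝ (LinearMap.range A) = 1) ↔
          ¬ RowsOverlap D) := by
  
  have hskew := hρ.skew hX
  obtain ⟨C, hC, b, hb⟩ := exists_isSkewTableau hX hskew hρ.degree
  refine ⟨⟨_, C, hC, ⟨b, hb⟩, rfl⟩, hb.exists_isNiceSl2 hX hskew hρ.degree, ?_⟩
  rintro D ⟨C, hC, ⟨b, hb⟩, rfl⟩ h e hsl
  rw [not_rowsOverlap_iff hC]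
  constructor
  · rintro ⟨A, hA, h1⟩
    obtain ⟨u, hu, hu0, hup⟩ := exists_mem_ker_of_rank_one hX hskew hρ.degree hA h1
    exact hb.exists_delta_of_mem_ker hX hskew hC hu hu0 hup
  · rintro ⟨s, l, hc, hl⟩
    obtain ⟨i, hi, u, hui, hu, hu0⟩ := hb.exists_mem_ker_of_delta hc hl
    obtain ⟨Y, huY, hYP, hYh, hYe, hYf⟩ := exists_sl2_submodule hsl hi hui hu0
    exact ⟨symProd σ u u, map₂_symProd_le_lAlg hX hsl hYP hYh hYe hYf
      (Submodule.apply_mem_map₂ _ huY huY), finrank_range_symProd_self hX hu⟩
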